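/- **Setting.** Let $\mu$ be a measure on $\mathbb R$ and let $b,k:\mathbb R\to\mathbb R$ ($k$ measurable) be such that for every $\eta\in\mathbb R$ the function $q_\eta(y)=\exp\{y\eta-b(\eta)+k(y)\}$ is a probability density with respect to $\mu$. Assume that $b$ is strictly convex and three times differentiable and that, for a constant $C_{\rm dev}\ge 1$, $b''(x+t)\le C_{\rm dev}\,b''(x)$ for all $x\in\mathbb R$ and $|t|\le 1/2$. For each sample size $n$ let $p=p_n$, let $\mathbf X\in\mathbb R^{n\times p}$ be a fixed design with rows $x_i^\top$, and let $\theta_0\in\mathbb R^p$, $\theta_0\neq 0$. The data $\mathbf Y=(Y_1,\dots,Y_n)$ have independent coordinates, $Y_i$ with density $p_{i,\theta_0}$, where $p_{i,\theta}=q_{x_i^\top\theta}$; $\mathbb P_0$ and $\mathbb E$ denote probability and expectation under this law. Assume $p\ge n^{C}$ for a constant $C>0$. Let $S_\theta=\{j:\theta_j\ne0\}$, $S_0=S_{\theta_0}$, $s_0=|S_0|$, and let $s_{\max}$ satisfy $s_0\le s_{\max}\le\operatorname{rank}(\mathbf X)$. For $S\subseteq\{1,\dots,p\}$ let $\mathbf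 X_S$ (rows $x_{i,S}^\top$) consist of the columns of $\mathbf X$ in $S$ and, for $\theta_S\in\mathbb R^{S}$, put $$L_{n,\theta_S}=\sum_{i=1}^n\{Y_i\,x_{i,S}^\top\theta_S-b(x_{i,S}^\top\theta_S)+k(Y_i)\},\qquad \mathbf F_{n,\theta_S}=\sum_{i=1}^n b''(x_{i,S}^\top\theta_S)\,x_{i,S}x_{i,S}^\top ,$$ and write $L_{n,\theta}$ for the full model. Let $\hat\theta_S$ be a maximizer of $L_{n,\theta_S}$ (set to $0$ if none exists), and let $\theta_S^*$ be a maximizer of $\theta_S\mapsto\mathbb E L_{n,\theta_S}$ (after removal of the term $\sum_i k(Y_i)$, which is free of $\theta_S$). **Prior and posterior.** Let $w_n$ be a probability mass function on $\{0,\dots,s_{\max}\}$ such that, for constants $A_1,\dots,A_4>0$, $$A_1p^{-A_3}w_n(s-1)\le w_n(s)\le A_2p^{-A_4}w_n(s-1),\qquad 1\le s\le s_{\max}.$$ Under the prior $\Pi_n$ the support $S$ has probability $w_n(|S|)\binom{p}{|S|}^{-1}$ and, given $S$, $\theta_S$ has the density of $\mathcal N_{|S|}(\hat\theta_S,\{\lambda\mathbf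 F_{n,\hat\theta_S}\}^{-1})$, $\lambda=\lambda_n>0$, while all other coordinates vanish. For $\alpha\in(0,1)$ let $$\Pi^n_\alpha(A)=\frac{\int_A e^{\alpha L_{n,\theta}}\,\Pi_n(d\theta)}{\int e^{\alpha L_{n,\theta}}\,\Pi_n(d\theta)}\quad(A\subseteq\mathbb R^p\text{ measurable}),\qquad H_n(\theta_1,\theta_2)=\Big\{\frac1n\sum_{i=1}^n\int\big(\sqrt{p_{i,\theta_1}}-\sqrt{p_{i,\theta_2}}\big)^2d\mu\Big\}^{1/2}.$$ **(A1)** There are non-random $D_n>\sqrt2$ and $\overline\theta_S\in\mathbb R^{S}$ with $\mathbf F_{n,\overline\theta_S}$ nonsingular ($|S|\le s_{\max}$) such that, with $\mathbb P_0$-probability at least $1-p^{-1}$, for all $S$ with $|S|\le s_{\max}$ simultaneously: $L_{n,\theta_S}$ has a maximizer, $D_n^{-1}\mathbf F_{n,\overline\theta_S}\preceq\mathbf F_{n,\hat\theta_S}\preceq D_n\mathbf F_{n,\overline\theta_S}$, and $\|\mathbf F_{n,\overline\theta_S}^{1/2}(\hat\theta_S-\overline\theta_S)\|_2^2\le D_n|S|\log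 p$. Moreover $\mathbf F_{n,\theta^*_{S_0}}$ is nonsingular and $\max_{i\le n}\|\mathbf F_{n,\theta^*_{S_0}}^{-1/2}x_{i,S_0}\|_2^2\; s_0\log p=o(1)$. **(A2)** With $\rho_{\min},\rho_{\max}$ the smallest and largest eigenvalues of $\mathbf F_{n,\theta^*_{S_0}}$ and $\|\mathbf X_{S_0}\|_\infty=\max_i\sum_{j\in S_0}|x_{ij}|$, there is a constant $B$ with $$\log\Big(\max_{i\le n}b''(x_i^\top\theta_0)\vee\|\mathbf X_{S_0}\|_\infty\vee\rho_{\min}^{-1}\vee\rho_{\max}\Big)\le B\log p ,\qquad s_0\log p=o(n).$$ There are constants $A_5,A_6>0$, $A_7\ge0$ with $p^{-A_5}\le\lambda\le A_6p^{-A_7}$ and $A_6p^{-A_7}<A_4$, and $\log_p(D_n)=o(1)$. All non-asymptotic conditions are required for all sufficiently large $n$ only. **Theorem.** Under (A1)–(A2) and $\alpha\in(0,1)$ there is a constant $K_{\rm Hel}>0$, depending only on $b,k,\mu,C_{\rm dev},\alpha,C,B,A_1,\dots,A_7$, such that for all sufficiently large $n$, with $\epsilon_n=(s_0\log p/n)^{1/2}$,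 the posterior mass below is an integrable function of $\mathbf Y$ and $$\mathbb E\,\Pi^n_\alpha\{\theta:H_n(\theta,\theta_0)>K_{\rm Hel}\,\epsilon_n\}\le 2(s_0\log p)^{-1}+4p^{-1}+2p^{-s_0}.$$ -/

import Mathlib

open MeasureTheory Filter Topology Matrix

noncomputable section

namespace SparseGLM

/-! ## The generalized linear model with canonical link -/

/-- Log-density `y η - b η + k y` of a response with natural parameter `η`. -/
def logDensity (b k : ℝ → ℝ) (η y : ℝ) : ℝ := y * η - b η + k y

/-- Density `exp (y η - b η + k y)` with respect to the dominating measure. -/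
def density (b k : ℝ → ℝ) (η y : ℝ) : ℝ := Real.exp (logDensity b k η y)

/-- The standing assumptions on the exponential family: for every natural parameter the function
`density b k η` is a probability density with respect to `μ` (the response space is carried by
`μ`), `b` is strictly convex and three times differentiable, and `Cdev ≥ 1` satisfies
`sup_{|t| ≤ 1/2} b''(x + t) ≤ Cdev b''(x)` for all `x`. -/
structure IsFamily (b k : ℝ → ℝ) (μ : Measure ℝ) (Cdev : ℝ) : Prop where
  measurable_k : Measurable k
  normalized : ∀ η : ℝ, ∫⁻ y, ENNReal.ofReal (density b k η y) ∂μ = 1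
  strictConvex : StrictConvexOn ℝ Set.univ b
  diff_one : Differentiable ℝ b
  diff_two : Differentiable ℝ (deriv b)
  diff_three : Differentiable ℝ (deriv (deriv b))
  one_le : 1 ≤ Cdev
  dev : ∀ x t : ℝ, |t| ≤ 1 / 2 → deriv (deriv b) (x + t) ≤ Cdev * deriv (deriv b) x

/-- Joint law of `(Y_1, …, Y_n)`: the `Y_i` are independent and `Y_i` has density
`density b k (x_iᵀ θ)`. -/
def law {n p : ℕ} (b k : ℝ → ℝ) (μ : Measure ℝ) (X : Matrix (Fin n) (Fin p) ℝ)
    (θ : Fin p → ℝ) : Measure (Fin n → ℝ) :=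
  Measure.pi fun i => μ.withDensity fun y => ENNReal.ofReal (density b k ((X *ᵥ θ) i) y)

/-- Log-likelihood of a design with columns indexed by `ι`. -/
def logLik {n : ℕ} {ι : Type} [Fintype ι] (b k : ℝ → ℝ) (X : Matrix (Fin n) ι ℝ)
    (y : Fin n → ℝ) (θ : ι → ℝ) : ℝ :=
  ∑ i, logDensity b k ((X *ᵥ θ) i) (y i)

/-- Fisher information `Xᵀ W_θ X`, `W_θ = diag (b''(x_iᵀ θ))`. -/
def fisher {n : ℕ} {ι : Type} [Fintype ι] (b : ℝ → ℝ) (X : Matrix (Fin n) ι ℝ)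
    (θ : ι → ℝ) : Matrix ι ι ℝ :=
  Xᵀ * Matrix.diagonal (fun i => deriv (deriv b) ((X *ᵥ θ) i)) * X

theorem fisher_isHermitian {n : ℕ} {ι : Type} [Fintype ι] (b : ℝ → ℝ)
    (X : Matrix (Fin n) ι ℝ) (θ : ι → ℝ) : (fisher b X θ).IsHermitian := by
  unfold fisher Matrix.IsHermitian
  simp [Matrix.conjTranspose_eq_transpose_of_trivial, Matrix.transpose_mul, Matrix.mul_assoc]

/-! ## Submodels -/

/-- Support `S_θ`. -/
def supp {p : ℕ} (θ : Fin p → ℝ) : Finset (Fin p) := Finset.univ.filter fun j => θ j ≠ 0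

/-- The submatrix `X_S` of the columns in `S`. -/
def cols {n p : ℕ} (X : Matrix (Fin n) (Fin p) ℝ) (S : Finset (Fin p)) :
    Matrix (Fin n) S ℝ := fun i j => X i j

/-- The vector of `ℝ^p` that equals `θ_S` on `S` and vanishes off `S`. -/
def embed {p : ℕ} (S : Finset (Fin p)) (θ : S → ℝ) : Fin p → ℝ :=
  fun j => if h : j ∈ S then θ ⟨j, h⟩ else 0

/-- `θ` maximizes the log-likelihood. -/
def IsMLE {n : ℕ} {ι : Type} [Fintype ι] (b k : ℝ → ℝ) (X : Matrix (Fin n) ι ℝ)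
    (y : Fin n → ℝ) (θ : ι → ℝ) : Prop :=
  ∀ θ' : ι → ℝ, logLik b k X y θ' ≤ logLik b k X y θ

open Classical in
/-- The maximum likelihood estimator; by convention `0` for data without a maximizer. -/
def mle {n : ℕ} {ι : Type} [Fintype ι] (b k : ℝ → ℝ) (X : Matrix (Fin n) ι ℝ)
    (y : Fin n → ℝ) : ι → ℝ :=
  if h : ∃ θ, IsMLE b k X y θ then h.choose else 0

/-- `θ` maximizes the expected log-likelihood `θ' ↦ E L_{θ'}` of the design `X` when the data have
law `P`. Only differences of log-likelihoods enter, so that the summand `E k(Y_i)`, which is free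
of `θ`, need not be finite. -/
def IsBest {n : ℕ} {ι : Type} [Fintype ι] (b k : ℝ → ℝ) (P : Measure (Fin n → ℝ))
    (X : Matrix (Fin n) ι ℝ) (θ : ι → ℝ) : Prop :=
  ∀ θ' : ι → ℝ, ∫ y, (logLik b k X y θ' - logLik b k X y θ) ∂P ≤ 0

open Classical in
/-- The maximizer `θ*` of the expected log-likelihood (`0` if there is none). -/
def best {n : ℕ} {ι : Type} [Fintype ι] (b k : ℝ → ℝ) (P : Measure (Fin n → ℝ))
    (X : Matrix (Fin n) ι ℝ) : ι → ℝ :=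
  if h : ∃ θ, IsBest b k P X θ then h.choose else 0

/-- Fisher information of the true model `S₀ = S_{θ₀}` at `θ*_{S₀}`. -/
def fisherTrue {n p : ℕ} (b k : ℝ → ℝ) (μ : Measure ℝ) (X : Matrix (Fin n) (Fin p) ℝ)
    (θ₀ : Fin p → ℝ) : Matrix (supp θ₀) (supp θ₀) ℝ :=
  fisher b (cols X (supp θ₀)) (best b k (law b k μ X θ₀) (cols X (supp θ₀)))

theorem fisherTrue_isHermitian {n p : ℕ} (b k : ℝ → ℝ) (μ : Measure ℝ)
    (X : Matrix (Fin n) (Fin p) ℝ) (θ₀ : Fin p → ℝ) :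
    (fisherTrue b k μ X θ₀).IsHermitian := fisher_isHermitian _ _ _

/-- Smallest eigenvalue of `fisherTrue`. -/
def rhoMin {n p : ℕ} (b k : ℝ → ℝ) (μ : Measure ℝ) (X : Matrix (Fin n) (Fin p) ℝ)
    (θ₀ : Fin p → ℝ) : ℝ := ⨅ j, (fisherTrue_isHermitian b k μ X θ₀).eigenvalues j

/-- Largest eigenvalue of `fisherTrue`. -/
def rhoMax {n p : ℕ} (b k : ℝ → ℝ) (μ : Measure ℝ) (X : Matrix (Fin n) (Fin p) ℝ)
    (θ₀ : Fin p → ℝ) : ℝ := ⨆ j, (fisherTrue_isHermitian b k μ X θ₀).eigenvalues j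

/-- Square of the design regularity of the true model:
`max_i ‖F^{-1/2} x_{i,S₀}‖₂² = max_i x_{i,S₀}ᵀ F⁻¹ x_{i,S₀}`, `F = fisherTrue`. -/
def zetaSq {n p : ℕ} (b k : ℝ → ℝ) (μ : Measure ℝ) (X : Matrix (Fin n) (Fin p) ℝ)
    (θ₀ : Fin p → ℝ) : ℝ :=
  ⨆ i : Fin n, cols X (supp θ₀) i ⬝ᵥ ((fisherTrue b k μ X θ₀)⁻¹ *ᵥ cols X (supp θ₀) i)

/-- Maximal absolute row sum of a matrix. -/
def rowSumNorm {n : ℕ} {ι : Type} [Fintype ι] (A : Matrix (Fin n) ι ℝ) : ℝ :=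
  ⨆ i : Fin n, ∑ j, |A i j|

/-! ## Prior and fractional posterior -/

/-- Density at `x` of the normal distribution with mean `m` and (nonsingular) covariance `V`. -/
def normalDensity {ι : Type} [Fintype ι] [DecidableEq ι] (m : ι → ℝ) (V : Matrix ι ι ℝ)
    (x : ι → ℝ) : ℝ :=
  (2 * Real.pi) ^ (-(Fintype.card ι : ℝ) / 2) * V.det ^ (-(1 / 2) : ℝ) *
    Real.exp (-(1 / 2) * ((x - m) ⬝ᵥ (V⁻¹ *ᵥ (x - m))))

/-- The data-dependent slab density `g_S`: normal with mean the MLE of the model `S` and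
covariance `(lam F)⁻¹`, `F` the Fisher information at the MLE. -/
def slab {n p : ℕ} (b k : ℝ → ℝ) (X : Matrix (Fin n) (Fin p) ℝ) (lam : ℝ) (y : Fin n → ℝ)
    (S : Finset (Fin p)) (θ : S → ℝ) : ℝ :=
  normalDensity (mle b k (cols X S) y)
    (lam • fisher b (cols X S) (mle b k (cols X S) y))⁻¹ θ

/-- The empirical prior on `ℝ^p`: `S` has mass `w |S| / (p choose |S|)`, and given `S` the
coordinates in `S` have density `slab` and all others vanish. -/
def prior {n p : ℕ} (b k : ℝ → ℝ) (X : Matrix (Fin n) (Fin p) ℝ) (w : ℕ → ℝ) (lam : ℝ)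
    (y : Fin n → ℝ) : Measure (Fin p → ℝ) :=
  ∑ S : Finset (Fin p), ENNReal.ofReal (w S.card / (p.choose S.card : ℝ)) •
    Measure.map (embed S)
      ((volume : Measure (S → ℝ)).withDensity fun θ => ENNReal.ofReal (slab b k X lam y S θ))

/-- The mass that the `α`-fractional posterior gives to a measurable set `A`. -/
def posterior {n p : ℕ} (b k : ℝ → ℝ) (X : Matrix (Fin n) (Fin p) ℝ) (w : ℕ → ℝ) (lam α : ℝ)
    (y : Fin n → ℝ) (A : Set (Fin p → ℝ)) : ℝ :=
  ((∫⁻ θ in A, ENNReal.ofReal (Real.exp (α * logLik b k X y θ)) ∂(prior b k X w lam y)) /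
    (∫⁻ θ, ENNReal.ofReal (Real.exp (α * logLik b k X y θ)) ∂(prior b k X w lam y))).toReal

/-! ## Hellinger distance -/

/-- Squared Hellinger distance `∫ (√p₁ - √p₂)² dμ` between two members of the family. -/
def hellingerSq (b k : ℝ → ℝ) (μ : Measure ℝ) (η₁ η₂ : ℝ) : ℝ :=
  ∫ y, (Real.sqrt (density b k η₁ y) - Real.sqrt (density b k η₂ y)) ^ 2 ∂μ

/-- Mean Hellinger distance `H_n`. -/
def meanHellinger {n p : ℕ} (b k : ℝ → ℝ) (μ : Measure ℝ) (X : Matrix (Fin n) (Fin p) ℝ)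
    (θ₁ θ₂ : Fin p → ℝ) : ℝ :=
  Real.sqrt ((n : ℝ)⁻¹ * ∑ i, hellingerSq b k μ ((X *ᵥ θ₁) i) ((X *ᵥ θ₂) i))

/-! ## Assumptions on the sequence of models, indexed by the sample size `n` -/

/-- Standing assumptions: `p ≥ n^C`, `θ₀ ≠ 0`, `s₀ ≤ smax ≤ rank X`. -/
structure Standing (C : ℝ) (p : ℕ → ℕ) (X : ∀ n, Matrix (Fin n) (Fin (p n)) ℝ)
    (θ₀ : ∀ n, Fin (p n) → ℝ) (smax : ℕ → ℕ) : Prop where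
  dim : ∀ᶠ n : ℕ in atTop, (n : ℝ) ^ C ≤ (p n : ℝ)
  nonzero : ∀ᶠ n in atTop, θ₀ n ≠ 0
  sparse : ∀ᶠ n in atTop, (supp (θ₀ n)).card ≤ smax n
  rank : ∀ᶠ n in atTop, smax n ≤ (X n).rank

/-- Assumptions on the prior of the model size: `w n` is a probability mass function on
`{0, …, smax n}` that decreases at a polynomial rate in `p`. -/
structure SizePrior (A₁ A₂ A₃ A₄ : ℝ) (p smax : ℕ → ℕ) (w : ℕ → ℕ → ℝ) : Prop where
  nonneg : ∀ᶠ n in atTop, ∀ s, 0 ≤ w n s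
  zero : ∀ᶠ n in atTop, ∀ s, smax n < s → w n s = 0
  sum_one : ∀ᶠ n in atTop, ∑ s ∈ Finset.range (smax n + 1), w n s = 1
  lower : ∀ᶠ n in atTop, ∀ s, 1 ≤ s → s ≤ smax n →
    A₁ * (p n : ℝ) ^ (-A₃) * w n (s - 1) ≤ w n s
  upper : ∀ᶠ n in atTop, ∀ s, 1 ≤ s → s ≤ smax n →
    w n s ≤ A₂ * (p n : ℝ) ^ (-A₄) * w n (s - 1)

/-- The event that for every model `S` of size at most `smax` the MLE exists, that
`D⁻¹ F̄_S ⪯ F_{S,MLE} ⪯ D F̄_S` in the Loewner order, and that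
`‖F̄_S^{1/2} (MLE - θbar_S)‖₂² ≤ D |S| log p`, where `F̄_S` is the Fisher information of the model
`S` at `θbar_S`. -/
def mleEvent {n p : ℕ} (b k : ℝ → ℝ) (X : Matrix (Fin n) (Fin p) ℝ) (smax : ℕ) (D : ℝ)
    (θbar : ∀ S : Finset (Fin p), S → ℝ) : Set (Fin n → ℝ) :=
  {y | ∀ S : Finset (Fin p), S.card ≤ smax →
    (∃ θ, IsMLE b k (cols X S) y θ) ∧
    (fisher b (cols X S) (mle b k (cols X S) y)
      - D⁻¹ • fisher b (cols X S) (θbar S)).PosSemidef ∧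
    (D • fisher b (cols X S) (θbar S)
      - fisher b (cols X S) (mle b k (cols X S) y)).PosSemidef ∧
    (mle b k (cols X S) y - θbar S) ⬝ᵥ
        (fisher b (cols X S) (θbar S) *ᵥ (mle b k (cols X S) y - θbar S))
      ≤ D * S.card * Real.log p}

/-- First assumption: concentration of the model-wise MLEs around non-random points `θbar`, and
regularity of the design of the true model. -/
structure AssumptionOne (b k : ℝ → ℝ) (μ : Measure ℝ) (p : ℕ → ℕ)
    (X : ∀ n, Matrix (Fin n) (Fin (p n)) ℝ) (θ₀ : ∀ n, Fin (p n) → ℝ) (smax : ℕ → ℕ)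
    (D : ℕ → ℝ) (θbar : ∀ n, ∀ S : Finset (Fin (p n)), S → ℝ) : Prop where
  D_gt : ∀ᶠ n in atTop, Real.sqrt 2 < D n
  nonsing_bar : ∀ᶠ n in atTop, ∀ S : Finset (Fin (p n)), S.card ≤ smax n →
    (fisher b (cols (X n) S) (θbar n S)).det ≠ 0
  conc : ∀ᶠ n in atTop, 1 - (p n : ℝ)⁻¹ ≤
    (law b k μ (X n) (θ₀ n)).real (mleEvent b k (X n) (smax n) (D n) (θbar n))
  nonsing_true : ∀ᶠ n in atTop, (fisherTrue b k μ (X n) (θ₀ n)).det ≠ 0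
  design : Tendsto (fun n => zetaSq b k μ (X n) (θ₀ n) * (supp (θ₀ n)).card * Real.log (p n))
    atTop (𝓝 0)

/-- Second assumption: growth conditions (`B` is the implied constant of the bound `O(log p)`) and
conditions on the prior precision `lam`. -/
structure AssumptionTwo (b k : ℝ → ℝ) (μ : Measure ℝ) (B A₄ A₅ A₆ A₇ : ℝ) (p : ℕ → ℕ)
    (X : ∀ n, Matrix (Fin n) (Fin (p n)) ℝ) (θ₀ : ∀ n, Fin (p n) → ℝ)
    (lam D : ℕ → ℝ) : Prop where
  growth : ∀ᶠ n in atTop,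
    Real.log ((⨆ i : Fin n, deriv (deriv b) ((X n *ᵥ θ₀ n) i)) ⊔
        rowSumNorm (cols (X n) (supp (θ₀ n))) ⊔
        (rhoMin b k μ (X n) (θ₀ n))⁻¹ ⊔ rhoMax b k μ (X n) (θ₀ n))
      ≤ B * Real.log (p n)
  sample : Tendsto (fun n => (supp (θ₀ n)).card * Real.log (p n) / (n : ℝ)) atTop (𝓝 0)
  lam_lower : ∀ᶠ n in atTop, (p n : ℝ) ^ (-A₅) ≤ lam n
  lam_upper : ∀ᶠ n in atTop, lam n ≤ A₆ * (p n : ℝ) ^ (-A₇)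
  lam_A₄ : ∀ᶠ n in atTop, A₆ * (p n : ℝ) ^ (-A₇) < A₄
  log_D : Tendsto (fun n => Real.log (D n) / Real.log (p n)) atTop (𝓝 0)

/-- The rate `ε_n = (s₀ log p / n)^{1/2}`. -/
def rate {p : ℕ} (n : ℕ) (θ₀ : Fin p → ℝ) : ℝ :=
  Real.sqrt ((supp θ₀).card * Real.log p / n)

end SparseGLM

end

/-!
The theorem is a testing-free contraction argument for fractional posteriors: the posterior mass of
the set `A = {H_n (θ, θ₀) > K ε_n}` is a quotient, both sides of which are normalized by the
likelihood of `θ₀`, and one bounds the mean of the numerator from above and the denominator from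
below on an event of large probability.

*Numerator.* The model is an exponential family, so every exponential moment of an affine function
of the data is explicit (`IsFamily.lintegral_law_exp`). By convexity of `b` the mean of the
fractional likelihood ratio is at most `exp (-min α (1 - α) n H_n²)`
(`IsFamily.lintegral_likelihoodRatio_le`). The slab depends on the data, but on the event of the
first assumption it is at most `(√2 D p ^ (lam / 2)) ^ |S|` times a fixed normal density
(`gaussian_le_gaussian`, `IsFamily.slab_le`), so Fubini applies. As `D = p ^ o(1)` and
`lam < A₄`, the prior on the model size makes these factors summable over all models
(`sum_sizePrior_mul_pow_le`), and the numerator is at most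
`2 w(0) exp (-min α (1 - α) K² s₀ log p)` in mean (`IsFamily.lintegral_numerator_le`).

*Denominator.* Only the true support is kept. The maximizer of the expected log-likelihood in the
true model is `θ₀` itself (`IsFamily.best_eq`). A Chernoff bound for each coordinate of the
standardized score (`IsFamily.exists_score_bound`) and concavity (`IsFamily.mle_localization`)
place the maximum likelihood estimator so close to `θ₀` that the Fisher informations at both points
are comparable. On the ellipsoid `(θ - mle)ᵀ F (θ - mle) ≤ s₀` the log-likelihood is then within
`O(s₀)` of its maximum, and the slab gives this ellipsoid a mass that depends on `lam` and `s₀`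
only (`le_setLIntegral_gaussian`). With the prior mass of the true support the denominator is at
least `w(0) p ^ (-(A₃ + A₅ / 2 + 3) s₀)` (`IsFamily.le_denominator`, `le_supportMass_mul_pow`).

With `min α (1 - α) K² = A₃ + A₅ / 2 + 4` the quotient is at most `2 p ^ (-s₀)`, and the exceptional
events have probability at most `3 / p`. Measurability of the posterior in the data rests on that
of the maximum likelihood estimators: in every model that the prior charges the design has full
column rank, so the estimator is the inverse of an injective continuous map, applied to the
sufficient statistic (`IsFamily.measurable_mle`).
-/

namespace SparseGLM

variable {b k : ℝ → ℝ} {μ : Measure ℝ} {Cdev : ℝ}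

/-! ### Calculus of the cumulant function -/

namespace IsFamily

theorem strictMono_deriv (h : IsFamily b k μ Cdev) : StrictMono (deriv b) :=
  strictMonoOn_univ.1 (h.strictConvex.strictMonoOn_deriv fun x _ => h.diff_one x)

theorem continuous_b (h : IsFamily b k μ Cdev) : Continuous b := h.diff_one.continuous

theorem continuous_deriv (h : IsFamily b k μ Cdev) : Continuous (deriv b) :=
  h.diff_two.continuous

theorem continuous_deriv2 (h : IsFamily b k μ Cdev) : Continuous (deriv (deriv b)) :=
  h.diff_three.continuous

theorem deriv2_nonneg (h : IsFamily b k μ Cdev) (x : ℝ) : 0 ≤ deriv (deriv b) x :=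
  h.strictMono_deriv.monotone.deriv_nonneg

theorem deriv2_le (h : IsFamily b k μ Cdev) {x y : ℝ} (hxy : |y - x| ≤ 1 / 2) :
    deriv (deriv b) y ≤ Cdev * deriv (deriv b) x := by
  simpa using h.dev x (y - x) hxy

/-- A zero of `b''` would spread to an interval by the deviation bound, on which `b` would be
affine. -/
theorem deriv2_pos (h : IsFamily b k μ Cdev) (x : ℝ) : 0 < deriv (deriv b) x := by
  refine lt_of_le_of_ne (h.deriv2_nonneg x) fun h0 => ?_
  obtain ⟨c, hc, hc'⟩ := exists_deriv_eq_slope (deriv b) (show x < x + 1 / 2 by linarith)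
    h.continuous_deriv.continuousOn h.diff_two.differentiableOn
  have h1 : deriv (deriv b) c ≤ 0 := by
    have := h.deriv2_le (x := x) (y := c) (by rw [abs_le]; constructor <;> linarith [hc.1, hc.2])
    rwa [← h0, mul_zero] at this
  have h2 := h.strictMono_deriv (show x < x + 1 / 2 by linarith)
  rw [hc'] at h1
  have : 0 < (deriv b (x + 1 / 2) - deriv b x) / (x + 1 / 2 - x) := by
    apply div_pos <;> linarith
  linarith

theorem tangent_le (h : IsFamily b k μ Cdev) (x y : ℝ) :
    b x + deriv b x * (y - x) ≤ b y := by
  rcases lt_trichotomy x y with hxy | rfl | hxy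
  · have := h.strictConvex.convexOn.deriv_le_slope (Set.mem_univ x) (Set.mem_univ y) hxy
      (h.diff_one x)
    rw [slope_def_field, le_div_iff₀ (by linarith)] at this
    linarith
  · simp
  · have := h.strictConvex.convexOn.slope_le_deriv (Set.mem_univ y) (Set.mem_univ x) hxy
      (h.diff_one x)
    rw [slope_def_field, div_le_iff₀ (by linarith)] at this
    linarith

theorem exists_taylor (h : IsFamily b k μ Cdev) (x t : ℝ) :
    ∃ ξ, |ξ - x| ≤ |t| ∧ b (x + t) - b x - deriv b x * t = deriv (deriv b) ξ * t ^ 2 / 2 := by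
  rcases eq_or_ne t 0 with rfl | ht
  · exact ⟨x, by simp⟩
  have hne : x ≠ x + t := by simpa using ht
  have hC : ContDiff ℝ (1 + 1) b := by
    rw [contDiff_succ_iff_deriv]
    refine ⟨h.diff_one, by simp, ?_⟩
    rw [contDiff_one_iff_deriv]
    exact ⟨h.diff_two, h.continuous_deriv2⟩
  obtain ⟨ξ, hξ, hξ'⟩ := taylor_mean_remainder_lagrange_iteratedDeriv (n := 1) hne
    (by simpa using hC.contDiffOn)
  refine ⟨ξ, ?_, ?_⟩
  · rw [Set.uIoo, Set.mem_Ioo] at hξ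
    rcases le_total 0 t with h0 | h0
    · rw [inf_of_le_left (by linarith), sup_of_le_right (by linarith)] at hξ
      rw [abs_of_nonneg h0, abs_le]; constructor <;> linarith [hξ.1, hξ.2]
    · rw [inf_of_le_right (by linarith), sup_of_le_left (by linarith)] at hξ
      rw [abs_of_nonpos h0, abs_le]; constructor <;> linarith [hξ.1, hξ.2]
  · have hd : derivWithin b (Set.uIcc x (x + t)) x = deriv b x :=
      (h.diff_one x).derivWithin (uniqueDiffOn_uIcc hne x Set.left_mem_uIcc)
    rw [taylorWithinEval_succ, taylor_within_zero_eval, iteratedDerivWithin_one, hd] at hξ'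
    simp only [iteratedDeriv_succ, iteratedDeriv_zero] at hξ'
    norm_num at hξ'
    linarith

theorem taylor_upper (h : IsFamily b k μ Cdev) (x : ℝ) {t : ℝ} (ht : |t| ≤ 1 / 2) :
    b (x + t) - b x - deriv b x * t ≤ Cdev * deriv (deriv b) x * t ^ 2 / 2 := by
  obtain ⟨ξ, hξ, e⟩ := h.exists_taylor x t
  rw [e]
  have := h.deriv2_le (x := x) (y := ξ) (hξ.trans ht)
  have := mul_le_mul_of_nonneg_right this (sq_nonneg t)
  linarith

theorem taylor_lower (h : IsFamily b k μ Cdev) (x : ℝ) {t : ℝ} (ht : |t| ≤ 1 / 2) :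
    Cdev⁻¹ * deriv (deriv b) x * t ^ 2 / 2 ≤ b (x + t) - b x - deriv b x * t := by
  obtain ⟨ξ, hξ, e⟩ := h.exists_taylor x t
  rw [e]
  have h1 := h.deriv2_le (x := ξ) (y := x) (by rw [abs_sub_comm]; exact hξ.trans ht)
  have h2 : Cdev⁻¹ * deriv (deriv b) x ≤ deriv (deriv b) ξ := by
    rw [inv_mul_le_iff₀ (by linarith [h.one_le])]; exact h1
  have := mul_le_mul_of_nonneg_right h2 (sq_nonneg t)
  linarith

/-! ### Exponential moments and Hellinger affinity -/

theorem measurable_density (h : IsFamily b k μ Cdev) (η : ℝ) : Measurable (density b k η) := by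
  unfold density logDensity
  have := h.measurable_k
  fun_prop

theorem isProbabilityMeasure_withDensity (h : IsFamily b k μ Cdev) (η : ℝ) :
    IsProbabilityMeasure (μ.withDensity fun y => ENNReal.ofReal (density b k η y)) :=
  ⟨by rw [withDensity_apply _ MeasurableSet.univ, Measure.restrict_univ, h.normalized]⟩

theorem isProbabilityMeasure_law (h : IsFamily b k μ Cdev) {n p : ℕ}
    (X : Matrix (Fin n) (Fin p) ℝ) (θ : Fin p → ℝ) : IsProbabilityMeasure (law b k μ X θ) := by
  have := fun i => h.isProbabilityMeasure_withDensity ((X *ᵥ θ) i)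
  unfold law
  infer_instance

theorem density_mul_exp (η c d y : ℝ) :
    density b k η y * Real.exp (c * y + d)
      = density b k (η + c) y * Real.exp (b (η + c) - b η + d) := by
  simp only [density, logDensity, ← Real.exp_add]
  congr 1; ring

theorem lintegral_exp_affine (h : IsFamily b k μ Cdev) (η c d : ℝ) :
    ∫⁻ y, ENNReal.ofReal (Real.exp (c * y + d))
        ∂(μ.withDensity fun y => ENNReal.ofReal (density b k η y))
      = ENNReal.ofReal (Real.exp (b (η + c) - b η + d)) := by
  have hm := fun η => (h.measurable_density η).ennreal_ofReal
  rw [lintegral_withDensity_eq_lintegral_mul _ (hm η) (by fun_prop)]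
  have : ∀ y, ((fun y => ENNReal.ofReal (density b k η y)) *
      fun y => ENNReal.ofReal (Real.exp (c * y + d))) y =
      ENNReal.ofReal (density b k (η + c) y) *
        ENNReal.ofReal (Real.exp (b (η + c) - b η + d)) := fun y => by
    have h0 : ∀ η, 0 ≤ density b k η y := fun η => (Real.exp_pos _).le
    rw [Pi.mul_apply, ← ENNReal.ofReal_mul (h0 _), ← ENNReal.ofReal_mul (h0 _),
      density_mul_exp]
  simp_rw [this]
  rw [lintegral_mul_const _ (hm _), h.normalized, one_mul]

end IsFamily

theorem lintegral_pi_prod {ι : Type*} [Fintype ι] (ν : ι → Measure ℝ)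
    [∀ i, IsProbabilityMeasure (ν i)] (f : ι → ℝ → ENNReal) (hf : ∀ i, Measurable (f i)) :
    ∫⁻ y, ∏ i, f i (y i) ∂(Measure.pi ν) = ∏ i, ∫⁻ x, f i x ∂(ν i) := by
  refine (ProbabilityTheory.lintegral_prod_eq_prod_lintegral_of_indepFun
    (μ := Measure.pi ν) Finset.univ (fun i y => f i (y i))
    (ProbabilityTheory.iIndepFun_pi fun i => (hf i).aemeasurable)
    (fun i => (hf i).comp (measurable_pi_apply i))).trans ?_
  refine Finset.prod_congr rfl fun i _ => ?_
  rw [← (measurePreserving_eval ν i).lintegral_comp (hf i)]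

/-- Exponential moments of affine functions of the data; every probabilistic estimate below is an
instance of this formula. -/
theorem IsFamily.lintegral_law_exp (h : IsFamily b k μ Cdev) {n p : ℕ}
    (X : Matrix (Fin n) (Fin p) ℝ) (θ : Fin p → ℝ) (c d : Fin n → ℝ) :
    ∫⁻ y, ENNReal.ofReal (Real.exp (∑ i, (c i * y i + d i))) ∂(law b k μ X θ)
      = ENNReal.ofReal (Real.exp (∑ i, (b ((X *ᵥ θ) i + c i) - b ((X *ᵥ θ) i) + d i))) := by
  have := fun i => h.isProbabilityMeasure_withDensity ((X *ᵥ θ) i)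
  have e : ∀ z : Fin n → ℝ, ENNReal.ofReal (Real.exp (∑ i, z i))
      = ∏ i, ENNReal.ofReal (Real.exp (z i)) := fun z => by
    rw [Real.exp_sum, ENNReal.ofReal_prod_of_nonneg fun i _ => (Real.exp_pos _).le]
  simp_rw [e, law]
  rw [lintegral_pi_prod _ (fun i y => ENNReal.ofReal (Real.exp (c i * y + d i)))
    (fun i => by fun_prop)]
  simp_rw [h.lintegral_exp_affine]

theorem logLik_sub {n : ℕ} {ι κ : Type} [Fintype ι] [Fintype κ] (X : Matrix (Fin n) ι ℝ)
    (X' : Matrix (Fin n) κ ℝ) (y : Fin n → ℝ) (θ : ι → ℝ) (θ' : κ → ℝ) :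
    logLik b k X y θ - logLik b k X' y θ' = ∑ i, (((X *ᵥ θ) i - (X' *ᵥ θ') i) * y i
      + (b ((X' *ᵥ θ') i) - b ((X *ᵥ θ) i))) := by
  simp only [logLik, logDensity, ← Finset.sum_sub_distrib]
  exact Finset.sum_congr rfl fun i _ => by ring

/-- The Hellinger affinity of two members of the family is explicit: the geometric mean of their
densities is a multiple of the density at the midpoint. -/
theorem IsFamily.hellingerSq_eq (h : IsFamily b k μ Cdev) (η₁ η₂ : ℝ) :
    hellingerSq b k μ η₁ η₂
      = 2 - 2 * Real.exp (b ((η₁ + η₂) / 2) - (b η₁ + b η₂) / 2) := by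
  have hpos : ∀ η y, 0 ≤ density b k η y := fun η y => (Real.exp_pos _).le
  have hint : ∀ η, Integrable (fun y => density b k η y) μ := fun η =>
    ⟨(h.measurable_density η).aestronglyMeasurable, by
      rw [hasFiniteIntegral_iff_ofReal (ae_of_all _ fun y => hpos η y), h.normalized]
      exact ENNReal.one_lt_top⟩
  have hone : ∀ η, ∫ y, density b k η y ∂μ = 1 := fun η => by
    rw [integral_eq_lintegral_of_nonneg_ae (ae_of_all _ fun y => hpos η y)
      (h.measurable_density η).aestronglyMeasurable, h.normalized, ENNReal.toReal_one]
  have e : ∀ y, (Real.sqrt (density b k η₁ y) - Real.sqrt (density b k η₂ y)) ^ 2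
      = density b k η₁ y + density b k η₂ y -
        2 * Real.exp (b ((η₁ + η₂) / 2) - (b η₁ + b η₂) / 2) *
          density b k ((η₁ + η₂) / 2) y := fun y => by
    rw [sub_sq, Real.sq_sqrt (hpos _ _), Real.sq_sqrt (hpos _ _)]
    have : Real.sqrt (density b k η₁ y) * Real.sqrt (density b k η₂ y) =
        Real.exp (b ((η₁ + η₂) / 2) - (b η₁ + b η₂) / 2) * density b k ((η₁ + η₂) / 2) y := by
      simp only [density, logDensity, Real.sqrt_eq_rpow, ← Real.exp_mul, ← Real.exp_add]
      congr 1; ring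
    linear_combination (-2) * this
  unfold hellingerSq
  simp_rw [e]
  refine (integral_sub ((hint _).add (hint _)) ((hint _).const_mul _)).trans ?_
  simp only [Pi.add_apply]
  rw [integral_add (hint _) (hint _), integral_const_mul, hone, hone, hone]
  ring

theorem IsFamily.continuous_hellingerSq (h : IsFamily b k μ Cdev) (η₂ : ℝ) :
    Continuous fun η => hellingerSq b k μ η η₂ := by
  simp_rw [h.hellingerSq_eq]
  have := h.continuous_b
  fun_prop

/-- Comparison of the `α`-affinity with the Hellinger affinity: by convexity of `b`, the point
`α η₁ + (1 - α) η₂` being a convex combination of the midpoint and an end point. -/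
theorem IsFamily.renyi_le (h : IsFamily b k μ Cdev) {α : ℝ} (hα : α ∈ Set.Ioo (0 : ℝ) 1)
    (η₁ η₂ : ℝ) :
    b (η₂ + α * (η₁ - η₂)) - b η₂ + α * (b η₂ - b η₁)
      ≤ -(min α (1 - α) * hellingerSq b k μ η₁ η₂) := by
  obtain ⟨h0, h1⟩ := hα
  have hexp := Real.add_one_le_exp (b ((η₁ + η₂) / 2) - (b η₁ + b η₂) / 2)
  rw [h.hellingerSq_eq]
  set m := (η₁ + η₂) / 2 with hm
  have key : b (η₂ + α * (η₁ - η₂)) - b η₂ + α * (b η₂ - b η₁)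
      ≤ 2 * min α (1 - α) * (b m - (b η₁ + b η₂) / 2) := by
    rcases le_total α (1 - α) with hle | hle
    · rw [min_eq_left hle]
      have := h.strictConvex.convexOn.2 (Set.mem_univ m) (Set.mem_univ η₂)
        (show 0 ≤ 2 * α by linarith) (show 0 ≤ 1 - 2 * α by linarith) (by ring)
      simp only [smul_eq_mul] at this
      have e : 2 * α * m + (1 - 2 * α) * η₂ = η₂ + α * (η₁ - η₂) := by rw [hm]; ring
      rw [e] at this
      linarith
    · rw [min_eq_right hle]
      have := h.strictConvex.convexOn.2 (Set.mem_univ m) (Set.mem_univ η₁)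
        (show 0 ≤ 2 * (1 - α) by linarith) (show 0 ≤ 1 - 2 * (1 - α) by linarith) (by ring)
      simp only [smul_eq_mul] at this
      have e : 2 * (1 - α) * m + (1 - 2 * (1 - α)) * η₁ = η₂ + α * (η₁ - η₂) := by
        rw [hm]; ring
      rw [e] at this
      linarith
  have hc : 0 ≤ min α (1 - α) := le_min h0.le (by linarith)
  nlinarith

theorem sum_hellingerSq_eq {n p : ℕ} (hn : n ≠ 0) (X : Matrix (Fin n) (Fin p) ℝ)
    (θ₁ θ₂ : Fin p → ℝ) :
    ∑ i, hellingerSq b k μ ((X *ᵥ θ₁) i) ((X *ᵥ θ₂) i)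
      = n * meanHellinger b k μ X θ₁ θ₂ ^ 2 := by
  have h0 : 0 ≤ ∑ i, hellingerSq b k μ ((X *ᵥ θ₁) i) ((X *ᵥ θ₂) i) :=
    Finset.sum_nonneg fun i _ => integral_nonneg fun y => sq_nonneg _
  rw [meanHellinger, Real.sq_sqrt (by positivity)]
  field_simp

/-- Fractional likelihood ratios have exponentially small mean away from `θ₀`. -/
theorem IsFamily.lintegral_likelihoodRatio_le (h : IsFamily b k μ Cdev) {α : ℝ}
    (hα : α ∈ Set.Ioo (0 : ℝ) 1) {n p : ℕ} (hn : n ≠ 0) (X : Matrix (Fin n) (Fin p) ℝ)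
    (θ θ₀ : Fin p → ℝ) :
    ∫⁻ y, ENNReal.ofReal (Real.exp (α * (logLik b k X y θ - logLik b k X y θ₀)))
        ∂(law b k μ X θ₀)
      ≤ ENNReal.ofReal
          (Real.exp (-(min α (1 - α) * (n * meanHellinger b k μ X θ θ₀ ^ 2)))) := by
  have e : ∀ y, α * (logLik b k X y θ - logLik b k X y θ₀) =
      ∑ i, (α * ((X *ᵥ θ) i - (X *ᵥ θ₀) i) * y i
        + α * (b ((X *ᵥ θ₀) i) - b ((X *ᵥ θ) i))) := fun y => by
    rw [logLik_sub, Finset.mul_sum]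
    exact Finset.sum_congr rfl fun i _ => by ring
  simp_rw [e]
  rw [h.lintegral_law_exp, ← sum_hellingerSq_eq hn, Finset.mul_sum, ← Finset.sum_neg_distrib]
  exact ENNReal.ofReal_le_ofReal (Real.exp_le_exp.2
    (Finset.sum_le_sum fun i _ => h.renyi_le hα _ _))

/-! ### Gaussian integrals with a given precision matrix -/

theorem dotProduct_gram_mulVec {ι κ : Type} [Fintype ι] [Fintype κ] (G : Matrix κ ι ℝ)
    (u v : ι → ℝ) :
    u ⬝ᵥ ((Gᵀ * G) *ᵥ v) = (G *ᵥ u) ⬝ᵥ (G *ᵥ v) := by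
  rw [← Matrix.mulVec_mulVec, Matrix.dotProduct_mulVec, Matrix.vecMul_transpose]

theorem quadratic_sub_ge {ι : Type} [Fintype ι] {A : Matrix ι ι ℝ} (hA : A.PosSemidef)
    (u v : ι → ℝ) :
    (1 / 2) * (u ⬝ᵥ (A *ᵥ u)) - v ⬝ᵥ (A *ᵥ v) ≤ (u - v) ⬝ᵥ (A *ᵥ (u - v)) := by
  have h := hA.dotProduct_mulVec_nonneg (u - (2 : ℝ) • v)
  simp only [star_trivial, Matrix.mulVec_sub, Matrix.mulVec_smul, dotProduct_sub, sub_dotProduct,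
    dotProduct_smul, smul_dotProduct, smul_eq_mul] at h ⊢
  linarith

theorem lintegral_standard_gaussian {ι : Type} [Fintype ι] :
    ∫⁻ v : ι → ℝ, ENNReal.ofReal (∏ i, Real.exp (-(1 / 2) * v i ^ 2))
      = ENNReal.ofReal (√(2 * Real.pi) ^ Fintype.card ι) := by
  have hint : Integrable fun x : ℝ => Real.exp (-(1 / 2) * x ^ 2) :=
    integrable_exp_neg_mul_sq (by norm_num)
  rw [volume_pi, ← ofReal_integral_eq_lintegral_ofReal (Integrable.fintype_prod fun _ => hint)
    (ae_of_all _ fun v => Finset.prod_nonneg fun i _ => (Real.exp_pos _).le), ← volume_pi,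
    integral_fintype_prod_volume_eq_pow fun x : ℝ => Real.exp (-(1 / 2) * x ^ 2),
    integral_gaussian]
  congr 3
  ring

section Gaussian

variable {ι : Type} [Fintype ι] [DecidableEq ι]

/-- A square root of a positive definite matrix, used to standardize vectors. -/
theorem exists_transpose_mul_self {A : Matrix ι ι ℝ} (hA : A.PosDef) :
    ∃ G : Matrix ι ι ℝ, A = Gᵀ * G ∧ G.det ≠ 0 := by
  obtain ⟨G, hG⟩ : ∃ G, A = star G * G := by
    open scoped MatrixOrder in
    exact CStarAlgebra.nonneg_iff_eq_star_mul_self.mp hA.posSemidef.nonneg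
  have hG' : A = Gᵀ * G := by
    rw [hG, Matrix.star_eq_conjTranspose, Matrix.conjTranspose_eq_transpose_of_trivial]
  refine ⟨G, hG', fun h0 => hA.det_pos.ne' ?_⟩
  rw [hG', Matrix.det_mul, h0, mul_zero]

theorem lintegral_comp_mulVec {G : Matrix ι ι ℝ} (hG : G.det ≠ 0) (f : (ι → ℝ) → ENNReal)
    (hf : Measurable f) :
    ∫⁻ v, f (G *ᵥ v) = ENNReal.ofReal |G.det|⁻¹ * ∫⁻ v, f v := by
  have hm : Measurable (Matrix.toLin' G) := (LinearMap.continuous_on_pi _).measurable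
  have := lintegral_map (μ := volume) hf hm
  rw [Real.map_matrix_volume_pi_eq_smul_volume_pi hG, lintegral_smul_measure] at this
  simp only [Matrix.toLin'_apply] at this
  rw [← this, abs_inv, smul_eq_mul]

theorem abs_det_inv_of_eq {A G : Matrix ι ι ℝ} (h : A = Gᵀ * G) :
    |G.det|⁻¹ = (√A.det)⁻¹ := by
  rw [h, Matrix.det_mul, Matrix.det_transpose, Real.sqrt_mul_self_eq_abs]

theorem lintegral_exp_quadratic {A : Matrix ι ι ℝ} (hA : A.PosDef) :
    ∫⁻ v : ι → ℝ, ENNReal.ofReal (Real.exp (-(1 / 2) * (v ⬝ᵥ (A *ᵥ v))))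
      = ENNReal.ofReal (√(2 * Real.pi) ^ Fintype.card ι * (√A.det)⁻¹) := by
  obtain ⟨G, hG, hdet⟩ := exists_transpose_mul_self hA
  have e : ∀ v : ι → ℝ, ENNReal.ofReal (Real.exp (-(1 / 2) * (v ⬝ᵥ (A *ᵥ v)))) =
      (fun u : ι → ℝ => ENNReal.ofReal (∏ i, Real.exp (-(1 / 2) * u i ^ 2))) (G *ᵥ v) := fun v => by
    rw [hG, dotProduct_gram_mulVec]
    simp only
    rw [← Real.exp_sum, ← Finset.mul_sum]
    simp only [dotProduct, pow_two]
  rw [lintegral_congr e, lintegral_comp_mulVec hdet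
      (fun u : ι → ℝ => ENNReal.ofReal (∏ i, Real.exp (-(1 / 2) * u i ^ 2))) (by fun_prop),
    lintegral_standard_gaussian, abs_det_inv_of_eq hG, ← ENNReal.ofReal_mul (by positivity),
    mul_comm]

/-- Monotonicity of the determinant in the Loewner order, read off from the Gaussian integrals. -/
theorem det_le_det_of_posSemidef_sub {A B : Matrix ι ι ℝ} (hA : A.PosDef) (hB : B.PosDef)
    (h : (B - A).PosSemidef) : A.det ≤ B.det := by
  have hle : ∫⁻ v : ι → ℝ, ENNReal.ofReal (Real.exp (-(1 / 2) * (v ⬝ᵥ (B *ᵥ v))))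
      ≤ ∫⁻ v : ι → ℝ, ENNReal.ofReal (Real.exp (-(1 / 2) * (v ⬝ᵥ (A *ᵥ v)))) := by
    refine lintegral_mono fun v => ENNReal.ofReal_le_ofReal (Real.exp_le_exp.2 ?_)
    have := h.dotProduct_mulVec_nonneg v
    rw [Matrix.sub_mulVec, dotProduct_sub] at this
    simp only [star_trivial] at this
    linarith
  rw [lintegral_exp_quadratic hA, lintegral_exp_quadratic hB,
    ENNReal.ofReal_le_ofReal_iff (by positivity)] at hle
  have hpi : 0 < √(2 * Real.pi) ^ Fintype.card ι := by positivity
  have h1 := le_of_mul_le_mul_left hle hpi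
  rw [inv_le_inv₀ (Real.sqrt_pos.2 hB.det_pos) (Real.sqrt_pos.2 hA.det_pos)] at h1
  exact (Real.sqrt_le_sqrt_iff hB.det_pos.le).1 h1

/-- Normal density with mean `m`, parametrized by its precision matrix `A`. -/
noncomputable def gaussian (m : ι → ℝ) (A : Matrix ι ι ℝ) (x : ι → ℝ) : ℝ :=
  (√(2 * Real.pi) ^ Fintype.card ι)⁻¹ * √A.det
    * Real.exp (-(1 / 2) * ((x - m) ⬝ᵥ (A *ᵥ (x - m))))

theorem gaussian_nonneg (m : ι → ℝ) (A : Matrix ι ι ℝ) (x : ι → ℝ) : 0 ≤ gaussian m A x := by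
  unfold gaussian; positivity

theorem normalDensity_inv_eq (m : ι → ℝ) {A : Matrix ι ι ℝ} (hA : A.PosDef) (x : ι → ℝ) :
    normalDensity m A⁻¹ x = gaussian m A x := by
  have hd := hA.det_pos
  unfold normalDensity gaussian
  rw [Matrix.nonsing_inv_nonsing_inv _ hd.ne'.isUnit]
  congr 2
  · rw [Real.sqrt_eq_rpow, ← Real.rpow_natCast, ← Real.rpow_mul (by positivity),
      ← Real.rpow_neg (by positivity)]
    congr 1; ring
  · rw [Matrix.det_nonsing_inv, Ring.inverse_eq_inv', Real.rpow_neg (by positivity),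
      Real.inv_rpow hd.le, inv_inv, Real.sqrt_eq_rpow]

theorem measurable_gaussian (m : ι → ℝ) (A : Matrix ι ι ℝ) : Measurable (gaussian m A) := by
  unfold gaussian dotProduct mulVec dotProduct
  fun_prop

theorem lintegral_gaussian (m : ι → ℝ) {A : Matrix ι ι ℝ} (hA : A.PosDef) :
    ∫⁻ x, ENNReal.ofReal (gaussian m A x) = 1 := by
  have hd := Real.sqrt_pos.2 hA.det_pos
  have hpi : 0 < √(2 * Real.pi) ^ Fintype.card ι := by positivity
  simp only [gaussian]
  simp_rw [ENNReal.ofReal_mul (show 0 ≤ (√(2 * Real.pi) ^ Fintype.card ι)⁻¹ * √A.det by positivity)]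
  rw [lintegral_sub_right_eq_self (fun v : ι → ℝ => ENNReal.ofReal
      ((√(2 * Real.pi) ^ Fintype.card ι)⁻¹ * √A.det) *
        ENNReal.ofReal (Real.exp (-(1 / 2) * (v ⬝ᵥ (A *ᵥ v))))) m,
    lintegral_const_mul' _ _ ENNReal.ofReal_ne_top, lintegral_exp_quadratic hA,
    ← ENNReal.ofReal_mul (by positivity)]
  rw [ENNReal.ofReal_eq_one]
  field_simp

/-- The ellipsoid contains the image of the unit cube under a square root of the precision. -/
theorem le_volume_ellipsoid {A : Matrix ι ι ℝ} (hA : A.PosDef) :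
    ENNReal.ofReal (2 ^ Fintype.card ι * (√A.det)⁻¹)
      ≤ volume {v : ι → ℝ | v ⬝ᵥ (A *ᵥ v) ≤ Fintype.card ι} := by
  obtain ⟨G, hG, hdet⟩ := exists_transpose_mul_self hA
  have hsub : (fun v => G *ᵥ v) ⁻¹' (Set.Icc (-1) 1)
      ⊆ {v : ι → ℝ | v ⬝ᵥ (A *ᵥ v) ≤ Fintype.card ι} := by
    intro v hv
    simp only [Set.mem_preimage, Set.mem_Icc, Pi.le_def] at hv
    change v ⬝ᵥ (A *ᵥ v) ≤ Fintype.card ι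
    rw [hG, dotProduct_gram_mulVec, dotProduct, Fintype.card, Finset.cast_card]
    refine Finset.sum_le_sum fun i _ => ?_
    have h1 := hv.1 i
    have h2 := hv.2 i
    simp only [Pi.neg_apply, Pi.one_apply] at h1 h2
    nlinarith
  refine le_trans ?_ (measure_mono hsub)
  have hcube : volume (Set.Icc (-1) 1 : Set (ι → ℝ)) = ENNReal.ofReal (2 ^ Fintype.card ι) := by
    rw [Real.volume_Icc_pi]
    simp only [Pi.neg_apply, Pi.one_apply, Finset.prod_const, Finset.card_univ]
    rw [← ENNReal.ofReal_pow (by norm_num)]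
    norm_num
  have hm : MeasurableSet (Set.Icc (-1) 1 : Set (ι → ℝ)) := measurableSet_Icc
  have := lintegral_comp_mulVec hdet ((Set.Icc (-1) 1 : Set (ι → ℝ)).indicator 1)
    (measurable_one.indicator hm)
  rw [lintegral_indicator_one hm, hcube] at this
  have hm' : MeasurableSet ((fun v => G *ᵥ v) ⁻¹' (Set.Icc (-1) 1 : Set (ι → ℝ))) :=
    (show Measurable fun v => G *ᵥ v by unfold mulVec dotProduct; fun_prop) hm
  rw [← lintegral_indicator_one hm']
  have e : ∀ v, ((fun v => G *ᵥ v) ⁻¹' (Set.Icc (-1) 1 : Set (ι → ℝ))).indicator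
      (1 : (ι → ℝ) → ENNReal) v = (Set.Icc (-1) 1 : Set (ι → ℝ)).indicator 1 (G *ᵥ v) :=
    fun v => rfl
  simp_rw [e]
  rw [this, abs_det_inv_of_eq hG, ← ENNReal.ofReal_mul (by positivity), mul_comm]

theorem sqrt_det_smul {A : Matrix ι ι ℝ} {c : ℝ} (hc : 0 ≤ c) :
    √(c • A).det = √c ^ Fintype.card ι * √A.det := by
  rw [Matrix.det_smul, Real.sqrt_mul (by positivity)]
  congr 1
  rw [Real.sqrt_eq_iff_mul_self_eq (by positivity) (by positivity), ← mul_pow,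
    Real.mul_self_sqrt hc]

/-- Mass of a normal distribution with precision `c • A` near its mean, in terms of `c` alone. -/
theorem le_setLIntegral_gaussian (m : ι → ℝ) {A : Matrix ι ι ℝ} (hA : A.PosDef) {c : ℝ}
    (hc : 0 < c) :
    ENNReal.ofReal ((√c * (2 / √(2 * Real.pi)) * Real.exp (-(c / 2))) ^ Fintype.card ι)
      ≤ ∫⁻ x in {x | (x - m) ⬝ᵥ (A *ᵥ (x - m)) ≤ Fintype.card ι},
          ENNReal.ofReal (gaussian m (c • A) x) := by
  have hd := Real.sqrt_pos.2 hA.det_pos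
  set U := {x : ι → ℝ | (x - m) ⬝ᵥ (A *ᵥ (x - m)) ≤ Fintype.card ι} with hU
  have hvol : volume U = volume {v : ι → ℝ | v ⬝ᵥ (A *ᵥ v) ≤ Fintype.card ι} := by
    have := measure_preimage_add_right volume (-m) {v : ι → ℝ | v ⬝ᵥ (A *ᵥ v) ≤ Fintype.card ι}
    simp_rw [← sub_eq_add_neg] at this
    exact this
  have hUm : MeasurableSet U := by
    refine measurableSet_le ?_ measurable_const
    unfold dotProduct mulVec dotProduct
    fun_prop
  set g : ℝ := (√(2 * Real.pi) ^ Fintype.card ι)⁻¹ * √(c • A).det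
    * Real.exp (-(c / 2) * Fintype.card ι) with hg
  calc _ ≤ ENNReal.ofReal g * volume U := by
        rw [hvol]
        refine le_trans ?_ (mul_le_mul_right (le_volume_ellipsoid hA) _)
        rw [← ENNReal.ofReal_mul (by positivity)]
        refine ENNReal.ofReal_le_ofReal (le_of_eq ?_)
        rw [hg, sqrt_det_smul hc.le, mul_pow, mul_pow, div_pow, ← Real.exp_nat_mul,
          mul_comm (-(c / 2))]
        field_simp
    _ = ∫⁻ x in U, ENNReal.ofReal g := by simp
    _ ≤ _ := by
        refine setLIntegral_mono' hUm fun x hx => ENNReal.ofReal_le_ofReal ?_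
        rw [hg, gaussian]
        refine mul_le_mul_of_nonneg_left (Real.exp_le_exp.2 ?_) (by positivity)
        have hx' : (x - m) ⬝ᵥ (A *ᵥ (x - m)) ≤ Fintype.card ι := hx
        rw [Matrix.smul_mulVec, dotProduct_smul, smul_eq_mul]
        nlinarith

/-- A normal density with random mean and precision close to deterministic ones is bounded by a
multiple of a deterministic normal density with a deflated precision. -/
theorem gaussian_le_gaussian (m m' : ι → ℝ) {A A' : Matrix ι ι ℝ} (hA : A.PosDef)
    (hA' : A'.PosDef) {D c r : ℝ} (hD : 0 < D) (hc : 0 < c)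
    (hlow : (A - D⁻¹ • A').PosSemidef) (hupp : (D • A' - A).PosSemidef)
    (hr : (m - m') ⬝ᵥ (A' *ᵥ (m - m')) ≤ D * r) (x : ι → ℝ) :
    gaussian m (c • A) x ≤ (√2 * D) ^ Fintype.card ι * Real.exp (c * r / 2)
      * gaussian m' ((c / (2 * D)) • A') x := by
  have hdet : √(c • A).det ≤ (√2 * D) ^ Fintype.card ι * √((c / (2 * D)) • A').det := by
    have h1 : A.det ≤ (D • A').det :=
      det_le_det_of_posSemidef_sub hA (hA'.smul hD) hupp
    rw [sqrt_det_smul hc.le, sqrt_det_smul (by positivity), ← mul_assoc, ← mul_pow]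
    have h2 : √2 * D * √(c / (2 * D)) = √c * √D := by
      rw [Real.sqrt_div hc.le, Real.sqrt_mul (by norm_num)]
      have := Real.mul_self_sqrt hD.le
      have h3 := Real.sqrt_pos.2 hD
      field_simp
      linarith
    rw [h2, mul_pow, mul_assoc, ← sqrt_det_smul hD.le]
    exact mul_le_mul_of_nonneg_left (Real.sqrt_le_sqrt h1) (by positivity)
  have hexp : -(1 / 2) * ((x - m) ⬝ᵥ ((c • A) *ᵥ (x - m))) ≤
      c * r / 2 + -(1 / 2) * ((x - m') ⬝ᵥ (((c / (2 * D)) • A') *ᵥ (x - m'))) := by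
    have h1 := hlow.dotProduct_mulVec_nonneg (x - m)
    have h2 := quadratic_sub_ge hA'.posSemidef (x - m') (m - m')
    rw [sub_sub_sub_cancel_right] at h2
    simp only [star_trivial, Matrix.sub_mulVec, Matrix.smul_mulVec, dotProduct_sub,
      dotProduct_smul, smul_eq_mul] at h1 ⊢
    set q := (x - m) ⬝ᵥ (A *ᵥ (x - m))
    set q' := (x - m) ⬝ᵥ (A' *ᵥ (x - m))
    set q0 := (x - m') ⬝ᵥ (A' *ᵥ (x - m'))
    have h3 : D⁻¹ * ((1 / 2) * q0 - D * r) ≤ q := by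
      have : D⁻¹ * ((1 / 2) * q0 - D * r) ≤ D⁻¹ * q' :=
        mul_le_mul_of_nonneg_left (by linarith) (by positivity)
      linarith
    have h4 := mul_le_mul_of_nonneg_left h3 hc.le
    have e : c * (D⁻¹ * ((1 / 2) * q0 - D * r)) = c / (2 * D) * q0 - c * r := by
      field_simp
    linarith
  calc gaussian m (c • A) x
      ≤ (√(2 * Real.pi) ^ Fintype.card ι)⁻¹
        * ((√2 * D) ^ Fintype.card ι * √((c / (2 * D)) • A').det)
        * Real.exp (c * r / 2 + -(1 / 2) * ((x - m') ⬝ᵥ (((c / (2 * D)) • A') *ᵥ (x - m')))) := by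
        unfold gaussian; gcongr
    _ = _ := by rw [Real.exp_add, gaussian]; ring

end Gaussian

/-! ### Maximum likelihood for a design of full column rank -/

section Design

variable {n : ℕ} {ι : Type} [Fintype ι]

theorem logLik_diff (X : Matrix (Fin n) ι ℝ) (y : Fin n → ℝ) (θ θ' : ι → ℝ) :
    logLik b k X y θ' - logLik b k X y θ
      = ∑ i, (y i * ((X *ᵥ θ') i - (X *ᵥ θ) i) - (b ((X *ᵥ θ') i) - b ((X *ᵥ θ) i))) := by
  rw [logLik_sub]
  exact Finset.sum_congr rfl fun i _ => by ring

theorem fisher_quadratic (X : Matrix (Fin n) ι ℝ) (θ v : ι → ℝ) :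
    v ⬝ᵥ (fisher b X θ *ᵥ v) = ∑ i, deriv (deriv b) ((X *ᵥ θ) i) * (X *ᵥ v) i ^ 2 := by
  rw [fisher, Matrix.mul_assoc, ← Matrix.mulVec_mulVec, Matrix.dotProduct_mulVec,
    Matrix.vecMul_transpose, ← Matrix.mulVec_mulVec, dotProduct]
  refine Finset.sum_congr rfl fun i _ => ?_
  rw [Matrix.mulVec_diagonal]
  ring

theorem injective_of_fisher_det_ne_zero [DecidableEq ι] {X : Matrix (Fin n) ι ℝ} {θ : ι → ℝ}
    (h : (fisher b X θ).det ≠ 0) : Function.Injective (X *ᵥ ·) := by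
  have hi := Matrix.mulVec_injective_iff_isUnit.2
    ((Matrix.isUnit_iff_isUnit_det _).2 h.isUnit)
  intro u v huv
  apply hi
  simp only [fisher, ← Matrix.mulVec_mulVec] at huv ⊢
  rw [huv]

theorem IsFamily.fisher_posDef (h : IsFamily b k μ Cdev) {X : Matrix (Fin n) ι ℝ}
    (hX : Function.Injective (X *ᵥ ·)) (θ : ι → ℝ) : (fisher b X θ).PosDef := by
  refine Matrix.PosDef.of_dotProduct_mulVec_pos (fisher_isHermitian b X θ) fun v hv => ?_
  rw [star_trivial, fisher_quadratic]
  have hne : X *ᵥ v ≠ 0 := fun h0 => hv (hX (by simpa using h0))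
  obtain ⟨i, hi⟩ := Function.ne_iff.1 hne
  refine Finset.sum_pos' (fun i _ => mul_nonneg (h.deriv2_nonneg _) (sq_nonneg _))
    ⟨i, Finset.mem_univ i, mul_pos (h.deriv2_pos _) (sq_pos_of_ne_zero hi)⟩

/-- Mean of the sufficient statistic `Xᵀ Y` as a function of the parameter. -/
noncomputable def meanStat (b : ℝ → ℝ) (X : Matrix (Fin n) ι ℝ) (θ : ι → ℝ) : ι → ℝ :=
  Xᵀ *ᵥ fun i => deriv b ((X *ᵥ θ) i)

theorem transpose_mulVec_dotProduct (X : Matrix (Fin n) ι ℝ) (z : Fin n → ℝ) (v : ι → ℝ) :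
    (Xᵀ *ᵥ z) ⬝ᵥ v = ∑ i, z i * (X *ᵥ v) i := by
  rw [Matrix.mulVec_transpose, ← Matrix.dotProduct_mulVec, dotProduct]

theorem IsFamily.continuous_meanStat (h : IsFamily b k μ Cdev) (X : Matrix (Fin n) ι ℝ) :
    Continuous (meanStat b X) := by
  have := h.continuous_deriv
  unfold meanStat mulVec dotProduct
  fun_prop

theorem IsFamily.meanStat_injective (h : IsFamily b k μ Cdev) {X : Matrix (Fin n) ι ℝ}
    (hX : Function.Injective (X *ᵥ ·)) : Function.Injective (meanStat b X) := by
  intro θ θ' he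
  have h1 := transpose_mulVec_dotProduct X (fun i => deriv b ((X *ᵥ θ) i)) (θ - θ')
  have h2 := transpose_mulVec_dotProduct X (fun i => deriv b ((X *ᵥ θ') i)) (θ - θ')
  have he' : (Xᵀ *ᵥ fun i => deriv b ((X *ᵥ θ) i)) = Xᵀ *ᵥ fun i => deriv b ((X *ᵥ θ') i) := he
  rw [he', h2] at h1
  have h3 : ∑ i, (deriv b ((X *ᵥ θ) i) - deriv b ((X *ᵥ θ') i)) * ((X *ᵥ θ) i - (X *ᵥ θ') i)
      = 0 := by
    simp only [sub_mul, Finset.sum_sub_distrib, Matrix.mulVec_sub, Pi.sub_apply] at h1 ⊢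
    linarith
  have hnn : ∀ i ∈ Finset.univ, 0 ≤
      (deriv b ((X *ᵥ θ) i) - deriv b ((X *ᵥ θ') i)) * ((X *ᵥ θ) i - (X *ᵥ θ') i) := fun i _ => by
    rcases le_total ((X *ᵥ θ) i) ((X *ᵥ θ') i) with hl | hl
    · exact mul_nonneg_of_nonpos_of_nonpos
        (sub_nonpos.2 (h.strictMono_deriv.monotone hl)) (sub_nonpos.2 hl)
    · exact mul_nonneg (sub_nonneg.2 (h.strictMono_deriv.monotone hl)) (sub_nonneg.2 hl)
  rw [Finset.sum_eq_zero_iff_of_nonneg hnn] at h3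
  apply hX
  funext i
  rcases mul_eq_zero.1 (h3 i (Finset.mem_univ i)) with h4 | h4
  · exact h.strictMono_deriv.injective (sub_eq_zero.1 h4)
  · exact sub_eq_zero.1 h4

/-- The likelihood equations. -/
theorem IsFamily.isMLE_iff (h : IsFamily b k μ Cdev) {X : Matrix (Fin n) ι ℝ} {y : Fin n → ℝ}
    {θ : ι → ℝ} : IsMLE b k X y θ ↔ Xᵀ *ᵥ y = meanStat b X θ := by
  classical
  constructor
  · intro hm
    have hder : ∀ v : ι → ℝ, HasDerivAt (fun t : ℝ => logLik b k X y (θ + t • v))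
        (∑ i, (y i - deriv b ((X *ᵥ θ) i)) * (X *ᵥ v) i) 0 := fun v => by
      have e : (fun t : ℝ => logLik b k X y (θ + t • v)) = fun t => ∑ i,
          (y i * ((X *ᵥ θ) i + t * (X *ᵥ v) i) - b ((X *ᵥ θ) i + t * (X *ᵥ v) i) + k (y i)) := by
        funext t
        simp only [logLik, logDensity, Matrix.mulVec_add, Matrix.mulVec_smul, Pi.add_apply,
          Pi.smul_apply, smul_eq_mul]
      rw [e]
      refine HasDerivAt.fun_sum fun i _ => ?_
      have h1 : HasDerivAt (fun t : ℝ => (X *ᵥ θ) i + t * (X *ᵥ v) i) ((X *ᵥ v) i) 0 := by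
        simpa using ((hasDerivAt_id (0 : ℝ)).mul_const ((X *ᵥ v) i)).const_add ((X *ᵥ θ) i)
      have h2 : HasDerivAt b (deriv b ((X *ᵥ θ) i)) ((X *ᵥ θ) i + 0 * (X *ᵥ v) i) := by
        simpa using (h.diff_one ((X *ᵥ θ) i)).hasDerivAt
      have h3 := h2.comp (0 : ℝ) h1
      convert! ((h1.const_mul (y i)).sub h3).add_const (k (y i)) using 1
      ring
    have hzero : ∀ v : ι → ℝ, (Xᵀ *ᵥ y - meanStat b X θ) ⬝ᵥ v = 0 := fun v => by
      have hmax : IsLocalMax (fun t : ℝ => logLik b k X y (θ + t • v)) 0 :=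
        Eventually.of_forall fun t => by simpa using hm (θ + t • v)
      have := hmax.hasDerivAt_eq_zero (hder v)
      rw [sub_dotProduct, meanStat, transpose_mulVec_dotProduct, transpose_mulVec_dotProduct,
        ← Finset.sum_sub_distrib, ← this]
      exact Finset.sum_congr rfl fun i _ => by ring
    exact sub_eq_zero.1 (dotProduct_self_eq_zero.1 (hzero _))
  · intro he θ'
    have h1 := logLik_diff (b := b) (k := k) X y θ θ'
    have h2 := transpose_mulVec_dotProduct X y (θ' - θ)
    rw [he, meanStat, transpose_mulVec_dotProduct] at h2
    have h3 : ∑ i, deriv b ((X *ᵥ θ) i) * ((X *ᵥ θ') i - (X *ᵥ θ) i)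
        ≤ ∑ i, (b ((X *ᵥ θ') i) - b ((X *ᵥ θ) i)) :=
      Finset.sum_le_sum fun i _ => by linarith [h.tangent_le ((X *ᵥ θ) i) ((X *ᵥ θ') i)]
    simp only [Matrix.mulVec_sub, Pi.sub_apply] at h2
    rw [Finset.sum_sub_distrib] at h1
    linarith

theorem isMLE_mle {X : Matrix (Fin n) ι ℝ} {y : Fin n → ℝ} (h : ∃ θ, IsMLE b k X y θ) :
    IsMLE b k X y (mle b k X y) := by
  rw [mle, dif_pos h]
  exact h.choose_spec

theorem IsFamily.measurableEmbedding_meanStat (h : IsFamily b k μ Cdev) {X : Matrix (Fin n) ι ℝ}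
    (hX : Function.Injective (X *ᵥ ·)) : MeasurableEmbedding (meanStat b X) :=
  (h.continuous_meanStat X).measurableEmbedding (h.meanStat_injective hX)

theorem measurable_mulVec {κ : Type} [Fintype κ] (A : Matrix κ ι ℝ) : Measurable (A *ᵥ ·) := by
  unfold mulVec dotProduct
  fun_prop

theorem IsFamily.exists_isMLE_iff (h : IsFamily b k μ Cdev) {X : Matrix (Fin n) ι ℝ}
    {y : Fin n → ℝ} : (∃ θ, IsMLE b k X y θ) ↔ Xᵀ *ᵥ y ∈ Set.range (meanStat b X) := by
  simp only [h.isMLE_iff, Set.mem_range, eq_comm]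

theorem IsFamily.measurableSet_exists_isMLE (h : IsFamily b k μ Cdev) {X : Matrix (Fin n) ι ℝ}
    (hX : Function.Injective (X *ᵥ ·)) : MeasurableSet {y | ∃ θ, IsMLE b k X y θ} := by
  simp_rw [h.exists_isMLE_iff]
  exact measurable_mulVec Xᵀ (h.measurableEmbedding_meanStat hX).measurableSet_range

/-- The likelihood equations have at most one solution, which is a measurable function of the
sufficient statistic because an injective continuous map between Polish spaces has Borel image and
Borel inverse. -/
theorem IsFamily.measurable_mle (h : IsFamily b k μ Cdev) {X : Matrix (Fin n) ι ℝ}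
    (hX : Function.Injective (X *ᵥ ·)) : Measurable fun y => mle b k X y := by
  classical
  obtain ⟨g, hg, hgX⟩ := (h.measurableEmbedding_meanStat hX).exists_measurable_extend
    measurable_id fun _ => ⟨0⟩
  have e : (fun y => mle b k X y) = Set.piecewise {y | ∃ θ, IsMLE b k X y θ}
      (fun y => g (Xᵀ *ᵥ y)) (fun _ => 0) := by
    funext y
    by_cases hy : ∃ θ, IsMLE b k X y θ
    · rw [Set.piecewise_eq_of_mem _ _ _ (show y ∈ {y | ∃ θ, IsMLE b k X y θ} from hy),
        h.isMLE_iff.1 (isMLE_mle hy)]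
      exact (congrFun hgX (mle b k X y)).symm
    · rw [Set.piecewise_eq_of_notMem _ _ _ (show y ∉ {y | ∃ θ, IsMLE b k X y θ} from hy),
        mle, dif_neg hy]
  rw [e]
  exact Measurable.piecewise (h.measurableSet_exists_isMLE hX)
    (hg.comp (measurable_mulVec Xᵀ)) measurable_const

theorem IsFamily.continuous_fisher (h : IsFamily b k μ Cdev) (X : Matrix (Fin n) ι ℝ) :
    Continuous (fisher b X) := by
  have h2 := h.continuous_deriv2
  unfold fisher
  refine (continuous_const.matrix_mul (Continuous.matrix_diagonal ?_)).matrix_mul continuous_const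
  unfold mulVec dotProduct
  fun_prop

/-! ### The true parameter as the maximizer of the expected log-likelihood -/

theorem IsFamily.integrable_law_exp (h : IsFamily b k μ Cdev) {p : ℕ}
    (X : Matrix (Fin n) (Fin p) ℝ) (θ : Fin p → ℝ) (c d : Fin n → ℝ) :
    Integrable (fun y => Real.exp (∑ i, (c i * y i + d i))) (law b k μ X θ) := by
  refine ⟨Measurable.aestronglyMeasurable (by fun_prop), ?_⟩
  rw [hasFiniteIntegral_iff_ofReal (ae_of_all _ fun y => (Real.exp_pos _).le),
    h.lintegral_law_exp]
  exact ENNReal.ofReal_lt_top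

theorem IsFamily.integrable_law_affine (h : IsFamily b k μ Cdev) {p : ℕ}
    (X : Matrix (Fin n) (Fin p) ℝ) (θ : Fin p → ℝ) (c d : Fin n → ℝ) :
    Integrable (fun y : Fin n → ℝ => ∑ i, (c i * y i + d i)) (law b k μ X θ) := by
  refine ((h.integrable_law_exp X θ c d).add (h.integrable_law_exp X θ (-c) (-d))).mono
    (Measurable.aestronglyMeasurable (by fun_prop)) (ae_of_all _ fun y => ?_)
  have e : ∑ i, ((-c) i * y i + (-d) i) = -∑ i, (c i * y i + d i) := by
    rw [← Finset.sum_neg_distrib]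
    exact Finset.sum_congr rfl fun i _ => by simp only [Pi.neg_apply]; ring
  rw [Pi.add_apply, e]
  set s := ∑ i, (c i * y i + d i)
  have h1 := Real.add_one_le_exp s
  have h2 := Real.add_one_le_exp (-s)
  have h3 := Real.exp_pos s
  have h4 := Real.exp_pos (-s)
  rw [Real.norm_eq_abs, Real.norm_eq_abs, abs_of_pos (add_pos h3 h4), abs_le]
  constructor <;> linarith

/-- The mean of an affine function of the data is bounded by its exponential moment, since
`x ≤ exp x - 1`. -/
theorem IsFamily.integral_law_affine_le (h : IsFamily b k μ Cdev) {p : ℕ}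
    (X : Matrix (Fin n) (Fin p) ℝ) (θ : Fin p → ℝ) (c d : Fin n → ℝ) :
    ∫ y, ∑ i, (c i * y i + d i) ∂(law b k μ X θ)
      ≤ Real.exp (∑ i, (b ((X *ᵥ θ) i + c i) - b ((X *ᵥ θ) i) + d i)) - 1 := by
  have := h.isProbabilityMeasure_law X θ
  have hexp : ∫ y, Real.exp (∑ i, (c i * y i + d i)) ∂(law b k μ X θ)
      = Real.exp (∑ i, (b ((X *ᵥ θ) i + c i) - b ((X *ᵥ θ) i) + d i)) := by
    rw [integral_eq_lintegral_of_nonneg_ae (ae_of_all _ fun y => (Real.exp_pos _).le)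
      (h.integrable_law_exp X θ c d).1, h.lintegral_law_exp,
      ENNReal.toReal_ofReal (Real.exp_pos _).le]
  calc _ ≤ ∫ y, (Real.exp (∑ i, (c i * y i + d i)) - 1) ∂(law b k μ X θ) :=
        integral_mono (h.integrable_law_affine X θ c d)
          ((h.integrable_law_exp X θ c d).sub (integrable_const 1)) fun y => by
            have := Real.add_one_le_exp (∑ i, (c i * y i + d i))
            change _ ≤ Real.exp (∑ i, (c i * y i + d i)) - 1
            linarith
    _ = _ := by
        rw [integral_sub (h.integrable_law_exp X θ c d) (integrable_const 1), hexp]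
        simp

/-- In a well-specified model of full column rank the true parameter is the only maximizer of the
expected log-likelihood. -/
theorem IsFamily.best_eq (h : IsFamily b k μ Cdev) {p : ℕ} (X : Matrix (Fin n) (Fin p) ℝ)
    (θ₀ : Fin p → ℝ) {X' : Matrix (Fin n) ι ℝ} (hX' : Function.Injective (X' *ᵥ ·)) {θ' : ι → ℝ}
    (hθ' : X' *ᵥ θ' = X *ᵥ θ₀) : best b k (law b k μ X θ₀) X' = θ' := by
  -- Half the log-likelihood ratio has an exponential moment equal to the Hellinger affinity.
  have key : ∀ θ : ι → ℝ, ∫ y, (logLik b k X' y θ - logLik b k X' y θ') ∂(law b k μ X θ₀)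
      ≤ 2 * (Real.exp (∑ i, (b (((X' *ᵥ θ) i + (X' *ᵥ θ') i) / 2)
        - (b ((X' *ᵥ θ) i) + b ((X' *ᵥ θ') i)) / 2)) - 1) := fun θ => by
    have h1 := h.integral_law_affine_le X θ₀ (fun i => ((X' *ᵥ θ) i - (X' *ᵥ θ') i) / 2)
      (fun i => (b ((X' *ᵥ θ') i) - b ((X' *ᵥ θ) i)) / 2)
    have e1 : ∀ y, logLik b k X' y θ - logLik b k X' y θ' =
        2 * ∑ i, (((X' *ᵥ θ) i - (X' *ᵥ θ') i) / 2 * y i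
          + (b ((X' *ᵥ θ') i) - b ((X' *ᵥ θ) i)) / 2) := fun y => by
      rw [logLik_sub, Finset.mul_sum]
      exact Finset.sum_congr rfl fun i _ => by ring
    simp_rw [e1]
    rw [integral_const_mul]
    refine mul_le_mul_of_nonneg_left (h1.trans (le_of_eq ?_)) (by norm_num)
    rw [← hθ']
    congr 2
    refine Finset.sum_congr rfl fun i _ => ?_
    have e : (X' *ᵥ θ') i + ((X' *ᵥ θ) i - (X' *ᵥ θ') i) / 2
        = ((X' *ᵥ θ) i + (X' *ᵥ θ') i) / 2 := by ring
    rw [e]; ring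
  have hterm : ∀ u v : ℝ, b ((u + v) / 2) - (b u + b v) / 2 ≤ 0 := fun u v => by
    have := h.strictConvex.convexOn.2 (Set.mem_univ u) (Set.mem_univ v)
      (show (0 : ℝ) ≤ 1 / 2 by norm_num) (show (0 : ℝ) ≤ 1 / 2 by norm_num) (by norm_num)
    simp only [smul_eq_mul] at this
    have e : 1 / 2 * u + 1 / 2 * v = (u + v) / 2 := by ring
    rw [e] at this; linarith
  have hbest : IsBest b k (law b k μ X θ₀) X' θ' := fun θ => by
    refine (key θ).trans ?_
    have : Real.exp (∑ i, (b (((X' *ᵥ θ) i + (X' *ᵥ θ') i) / 2)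
        - (b ((X' *ᵥ θ) i) + b ((X' *ᵥ θ') i)) / 2)) ≤ 1 :=
      Real.exp_le_one_iff.2 (Finset.sum_nonpos fun i _ => hterm _ _)
    linarith
  have hex : ∃ θ, IsBest b k (law b k μ X θ₀) X' θ := ⟨θ', hbest⟩
  rw [best, dif_pos hex]
  have hspec := hex.choose_spec
  set θ := hex.choose
  by_contra hne
  have hne' : X' *ᵥ θ ≠ X' *ᵥ θ' := fun he => hne (hX' he)
  obtain ⟨i, hi⟩ := Function.ne_iff.1 hne'
  have hlt : ∑ i, (b (((X' *ᵥ θ) i + (X' *ᵥ θ') i) / 2)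
      - (b ((X' *ᵥ θ) i) + b ((X' *ᵥ θ') i)) / 2) < 0 := by
    refine Finset.sum_neg' (fun i _ => hterm _ _) ⟨i, Finset.mem_univ i, ?_⟩
    have := h.strictConvex.2 (Set.mem_univ ((X' *ᵥ θ) i)) (Set.mem_univ ((X' *ᵥ θ') i)) hi
      (show (0 : ℝ) < 1 / 2 by norm_num) (show (0 : ℝ) < 1 / 2 by norm_num) (by norm_num)
    simp only [smul_eq_mul] at this
    have e : 1 / 2 * (X' *ᵥ θ) i + 1 / 2 * (X' *ᵥ θ') i
        = ((X' *ᵥ θ) i + (X' *ᵥ θ') i) / 2 := by ring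
    rw [e] at this; linarith
  have h1 := key θ
  have h2 := (Real.exp_lt_exp.2 hlt).trans_eq Real.exp_zero
  have h3 := hspec θ'
  have e : ∫ y, (logLik b k X' y θ' - logLik b k X' y θ) ∂(law b k μ X θ₀)
      = -∫ y, (logLik b k X' y θ - logLik b k X' y θ') ∂(law b k μ X θ₀) := by
    rw [← integral_neg]
    simp only [neg_sub]
  rw [e] at h3
  linarith

end Design

/-! ### Concentration of the score and localization of the maximum likelihood estimator -/

/-- Cauchy-Schwarz inequality for the norm of `A` and its dual norm. -/
theorem sq_dotProduct_le {ι : Type} [Fintype ι] [DecidableEq ι] {A : Matrix ι ι ℝ}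
    (hA : A.PosDef) (x v : ι → ℝ) :
    (x ⬝ᵥ v) ^ 2 ≤ (x ⬝ᵥ (A⁻¹ *ᵥ x)) * (v ⬝ᵥ (A *ᵥ v)) := by
  obtain ⟨G, hG, hdet⟩ := exists_transpose_mul_self hA
  have hinv : A *ᵥ (A⁻¹ *ᵥ x) = x := by
    rw [Matrix.mulVec_mulVec, Matrix.mul_nonsing_inv _ hA.det_pos.ne'.isUnit, Matrix.one_mulVec]
  set a := A⁻¹ *ᵥ x with ha
  have h1 : x ⬝ᵥ v = (G *ᵥ v) ⬝ᵥ (G *ᵥ a) := by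
    rw [← dotProduct_gram_mulVec, ← hG, hinv, dotProduct_comm]
  have h2 : x ⬝ᵥ a = (G *ᵥ a) ⬝ᵥ (G *ᵥ a) := by
    rw [← dotProduct_gram_mulVec, ← hG, hinv, dotProduct_comm]
  have h3 : v ⬝ᵥ (A *ᵥ v) = (G *ᵥ v) ⬝ᵥ (G *ᵥ v) := by rw [hG, dotProduct_gram_mulVec]
  rw [h1, h2, h3, mul_comm]
  simp only [dotProduct, ← pow_two]
  exact Finset.sum_mul_sq_le_sq_mul_sq _ _ _

section Score

variable {n p : ℕ} {ι : Type} [Fintype ι]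

/-- Derivative at `θ` of the log-likelihood in direction `v`. -/
noncomputable def score (b : ℝ → ℝ) (X : Matrix (Fin n) ι ℝ) (y : Fin n → ℝ) (θ v : ι → ℝ) : ℝ :=
  ∑ i, (y i - deriv b ((X *ᵥ θ) i)) * (X *ᵥ v) i

/-- The remainder of the first-order expansion of the log-likelihood. -/
theorem logLik_add_sub (X : Matrix (Fin n) ι ℝ) (y : Fin n → ℝ) (θ v : ι → ℝ) :
    logLik b k X y (θ + v) - logLik b k X y θ = score b X y θ v
      - ∑ i, (b ((X *ᵥ θ) i + (X *ᵥ v) i) - b ((X *ᵥ θ) i)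
        - deriv b ((X *ᵥ θ) i) * (X *ᵥ v) i) := by
  rw [logLik_diff, score, ← Finset.sum_sub_distrib]
  refine Finset.sum_congr rfl fun i _ => ?_
  simp only [Matrix.mulVec_add, Pi.add_apply]
  ring

theorem IsFamily.score_eq_zero (h : IsFamily b k μ Cdev) {X : Matrix (Fin n) ι ℝ} {y : Fin n → ℝ}
    {θ : ι → ℝ} (hm : IsMLE b k X y θ) (v : ι → ℝ) : score b X y θ v = 0 := by
  have h1 := transpose_mulVec_dotProduct X y v
  rw [h.isMLE_iff.1 hm, meanStat, transpose_mulVec_dotProduct] at h1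
  simp only [score, sub_mul, Finset.sum_sub_distrib]
  linarith

theorem IsFamily.logLik_add_sub_le (h : IsFamily b k μ Cdev) (X : Matrix (Fin n) ι ℝ)
    (y : Fin n → ℝ) (θ : ι → ℝ) {v : ι → ℝ} (hv : ∀ i, |(X *ᵥ v) i| ≤ 1 / 2) :
    logLik b k X y (θ + v) - logLik b k X y θ
      ≤ score b X y θ v - Cdev⁻¹ / 2 * (v ⬝ᵥ (fisher b X θ *ᵥ v)) := by
  rw [logLik_add_sub, fisher_quadratic, Finset.mul_sum]
  refine sub_le_sub_left (Finset.sum_le_sum fun i _ => ?_) _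
  refine le_trans (le_of_eq ?_) (h.taylor_lower ((X *ᵥ θ) i) (hv i))
  ring

theorem IsFamily.le_logLik_add_sub (h : IsFamily b k μ Cdev) (X : Matrix (Fin n) ι ℝ)
    (y : Fin n → ℝ) (θ : ι → ℝ) {v : ι → ℝ} (hv : ∀ i, |(X *ᵥ v) i| ≤ 1 / 2) :
    score b X y θ v - Cdev / 2 * (v ⬝ᵥ (fisher b X θ *ᵥ v))
      ≤ logLik b k X y (θ + v) - logLik b k X y θ := by
  rw [logLik_add_sub, fisher_quadratic, Finset.mul_sum]
  refine sub_le_sub_left (Finset.sum_le_sum fun i _ => ?_) _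
  refine (h.taylor_upper ((X *ᵥ θ) i) (hv i)).trans (le_of_eq ?_)
  ring

/-- Chernoff bound for the score in one direction; the exponential moment is controlled by the
Taylor bound, which requires the direction to be small on every row of the design. -/
theorem IsFamily.measure_score_ge_le (h : IsFamily b k μ Cdev) (X : Matrix (Fin n) (Fin p) ℝ)
    (θ₀ : Fin p → ℝ) {X' : Matrix (Fin n) ι ℝ} {θ' : ι → ℝ} (hθ' : X' *ᵥ θ' = X *ᵥ θ₀)
    {g : ι → ℝ} (hg : g ⬝ᵥ (fisher b X' θ' *ᵥ g) ≤ 1) {t : ℝ} (ht : 0 ≤ t)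
    (hsmall : ∀ i, |t / Cdev * (X' *ᵥ g) i| ≤ 1 / 2) :
    law b k μ X θ₀ {y | t ≤ score b X' y θ' g}
      ≤ ENNReal.ofReal (Real.exp (-(t ^ 2 / (2 * Cdev)))) := by
  have hC : 0 < Cdev := by linarith [h.one_le]
  set s := t / Cdev with hs
  have hs0 : 0 ≤ s := by positivity
  have hst : s * Cdev = t := by rw [hs]; field_simp
  have e : ∀ y, s * score b X' y θ' g - s * t = ∑ i, (s * (X' *ᵥ g) i * y i
      + (-(deriv b ((X' *ᵥ θ') i) * (s * (X' *ᵥ g) i)))) - s * t := fun y => by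
    rw [score, Finset.mul_sum]
    congr 1
    exact Finset.sum_congr rfl fun i _ => by ring
  have hbound : ∑ i, (b ((X *ᵥ θ₀) i + s * (X' *ᵥ g) i) - b ((X *ᵥ θ₀) i)
      + (-(deriv b ((X' *ᵥ θ') i) * (s * (X' *ᵥ g) i)))) ≤ Cdev / 2 * s ^ 2 := by
    calc _ ≤ ∑ i, Cdev / 2 * s ^ 2 * (deriv (deriv b) ((X' *ᵥ θ') i) * (X' *ᵥ g) i ^ 2) := by
          refine Finset.sum_le_sum fun i _ => ?_
          rw [← hθ', ← sub_eq_add_neg]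
          exact (h.taylor_upper _ (hsmall i)).trans (le_of_eq (by ring))
      _ = Cdev / 2 * s ^ 2 * (g ⬝ᵥ (fisher b X' θ' *ᵥ g)) := by
          rw [fisher_quadratic, Finset.mul_sum]
      _ ≤ _ := mul_le_of_le_one_right (by positivity) hg
  calc law b k μ X θ₀ {y | t ≤ score b X' y θ' g}
      ≤ law b k μ X θ₀ {y | 1 ≤ ENNReal.ofReal (Real.exp (s * score b X' y θ' g - s * t))} := by
        refine measure_mono fun y hy => ?_
        have hy' : t ≤ score b X' y θ' g := hy
        change 1 ≤ ENNReal.ofReal _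
        rw [ENNReal.one_le_ofReal]
        refine Real.one_le_exp ?_
        nlinarith
    _ ≤ ∫⁻ y, ENNReal.ofReal (Real.exp (s * score b X' y θ' g - s * t)) ∂law b k μ X θ₀ := by
        have := mul_meas_ge_le_lintegral (μ := law b k μ X θ₀)
          (f := fun y => ENNReal.ofReal (Real.exp (s * score b X' y θ' g - s * t)))
          (by unfold score; fun_prop) 1
        rwa [one_mul] at this
    _ = ENNReal.ofReal (Real.exp (-(s * t))) * ENNReal.ofReal (Real.exp
        (∑ i, (b ((X *ᵥ θ₀) i + s * (X' *ᵥ g) i) - b ((X *ᵥ θ₀) i)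
          + (-(deriv b ((X' *ᵥ θ') i) * (s * (X' *ᵥ g) i)))))) := by
        rw [← h.lintegral_law_exp, ← lintegral_const_mul' _ _ ENNReal.ofReal_ne_top]
        refine lintegral_congr fun y => ?_
        rw [e, ← ENNReal.ofReal_mul (Real.exp_pos _).le, ← Real.exp_add]
        congr 2; ring
    _ ≤ _ := by
        rw [← ENNReal.ofReal_mul (Real.exp_pos _).le, ← Real.exp_add]
        refine ENNReal.ofReal_le_ofReal (Real.exp_le_exp.2 ?_)
        have : t ^ 2 / (2 * Cdev) = s * t - Cdev / 2 * s ^ 2 := by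
          rw [← hst]; field_simp; ring
        linarith

theorem score_neg (X : Matrix (Fin n) ι ℝ) (y : Fin n → ℝ) (θ v : ι → ℝ) :
    score b X y θ (-v) = -score b X y θ v := by
  simp [score, Matrix.mulVec_neg]

theorem score_sum {κ : Type} [Fintype κ] (X : Matrix (Fin n) ι ℝ) (y : Fin n → ℝ) (θ : ι → ℝ)
    (c : κ → ℝ) (g : κ → ι → ℝ) :
    score b X y θ (∑ j, c j • g j) = ∑ j, c j * score b X y θ (g j) := by
  simp only [score, Matrix.mulVec_sum, Matrix.mulVec_smul, Finset.sum_apply, Pi.smul_apply,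
    smul_eq_mul, Finset.mul_sum]
  rw [Finset.sum_comm]
  exact Finset.sum_congr rfl fun j _ => Finset.sum_congr rfl fun i _ => by ring

/-- A direction with small Fisher norm is small on every row of a regular design. -/
theorem abs_mulVec_le [DecidableEq ι] {X : Matrix (Fin n) ι ℝ} {A : Matrix ι ι ℝ} (hA : A.PosDef)
    {z : ℝ} (hz : ∀ i, X i ⬝ᵥ (A⁻¹ *ᵥ X i) ≤ z) {v : ι → ℝ} {q : ℝ}
    (hv : v ⬝ᵥ (A *ᵥ v) ≤ q) (hq : z * q ≤ 1 / 4) (i : Fin n) : |(X *ᵥ v) i| ≤ 1 / 2 := by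
  have h1 : (X *ᵥ v) i ^ 2 ≤ 1 / 4 := by
    have h0 : 0 ≤ v ⬝ᵥ (A *ᵥ v) := by simpa using hA.posSemidef.dotProduct_mulVec_nonneg v
    have h0' : 0 ≤ X i ⬝ᵥ (A⁻¹ *ᵥ X i) := by
      simpa using hA.inv.posSemidef.dotProduct_mulVec_nonneg (X i)
    calc (X *ᵥ v) i ^ 2 ≤ (X i ⬝ᵥ (A⁻¹ *ᵥ X i)) * (v ⬝ᵥ (A *ᵥ v)) := sq_dotProduct_le hA _ _
      _ ≤ z * q := mul_le_mul (hz i) hv h0 (h0'.trans (hz i))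
      _ ≤ 1 / 4 := hq
  exact abs_le_of_sq_le_sq (by linarith) (by norm_num)

/-- With high probability the score at the true parameter is bounded in the dual of the Fisher
norm: union bound over the coordinates of the standardized score. -/
theorem IsFamily.exists_score_bound [DecidableEq ι] (h : IsFamily b k μ Cdev)
    (X : Matrix (Fin n) (Fin p) ℝ) (θ₀ : Fin p → ℝ) {X' : Matrix (Fin n) ι ℝ} {θ' : ι → ℝ}
    (hX' : Function.Injective (X' *ᵥ ·)) (hθ' : X' *ᵥ θ' = X *ᵥ θ₀) {z : ℝ}
    (hz : ∀ i, X' i ⬝ᵥ ((fisher b X' θ')⁻¹ *ᵥ X' i) ≤ z) {t : ℝ} (ht : 0 ≤ t)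
    (htz : z * (t / Cdev) ^ 2 ≤ 1 / 4) :
    ∃ N : Set (Fin n → ℝ), MeasurableSet N ∧
      law b k μ X θ₀ N
        ≤ ENNReal.ofReal (2 * Fintype.card ι * Real.exp (-(t ^ 2 / (2 * Cdev)))) ∧
      ∀ y ∉ N, ∀ v, score b X' y θ' v ^ 2
        ≤ Fintype.card ι * t ^ 2 * (v ⬝ᵥ (fisher b X' θ' *ᵥ v)) := by
  have hF := h.fisher_posDef hX' θ'
  obtain ⟨G, hG, hdet⟩ := exists_transpose_mul_self hF
  have hGinv : ∀ v, G *ᵥ (G⁻¹ *ᵥ v) = v := fun v => by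
    rw [Matrix.mulVec_mulVec, Matrix.mul_nonsing_inv _ hdet.isUnit, Matrix.one_mulVec]
  have hGinv' : ∀ v, G⁻¹ *ᵥ (G *ᵥ v) = v := fun v => by
    rw [Matrix.mulVec_mulVec, Matrix.nonsing_inv_mul _ hdet.isUnit, Matrix.one_mulVec]
  set g : ι → ι → ℝ := fun j => G⁻¹ *ᵥ Pi.single j 1 with hg
  have hg1 : ∀ j, g j ⬝ᵥ (fisher b X' θ' *ᵥ g j) = 1 := fun j => by
    rw [hG, dotProduct_gram_mulVec, hg]
    simp only [hGinv]
    simp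
  have hexpand : ∀ v, v = ∑ j, (G *ᵥ v) j • g j := fun v => by
    conv_lhs => rw [← hGinv' v, pi_eq_sum_univ' (G *ᵥ v)]
    simp only [hg, Matrix.mulVec_sum, Matrix.mulVec_smul]
  have hsmall : ∀ j i, |t / Cdev * (X' *ᵥ g j) i| ≤ 1 / 2 := fun j i => by
    have := abs_mulVec_le hF hz (v := (t / Cdev) • g j) (q := (t / Cdev) ^ 2) (by
      rw [Matrix.mulVec_smul, dotProduct_smul, smul_dotProduct, hg1]
      simp [pow_two]) htz i
    rwa [Matrix.mulVec_smul, Pi.smul_apply, smul_eq_mul] at this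
  have hpos := fun j => h.measure_score_ge_le X θ₀ hθ' (hg1 j).le ht (hsmall j)
  have hneg := fun j => h.measure_score_ge_le X θ₀ hθ' (g := -g j)
    (by rw [Matrix.mulVec_neg, dotProduct_neg, neg_dotProduct, neg_neg]; exact (hg1 j).le) ht
    (fun i => by rw [Matrix.mulVec_neg, Pi.neg_apply, mul_neg, abs_neg]; exact hsmall j i)
  have hmeas : ∀ v, Measurable fun y => score b X' y θ' v := fun v => by
    unfold score; fun_prop
  refine ⟨⋃ j, ({y | t ≤ score b X' y θ' (g j)} ∪ {y | t ≤ score b X' y θ' (-g j)}),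
    MeasurableSet.iUnion fun j => (measurableSet_le measurable_const (hmeas _)).union
      (measurableSet_le measurable_const (hmeas _)), ?_, fun y hy v => ?_⟩
  · refine (measure_iUnion_le _).trans ?_
    rw [tsum_fintype]
    calc _ ≤ ∑ _j : ι, ENNReal.ofReal (2 * Real.exp (-(t ^ 2 / (2 * Cdev)))) := by
          refine Finset.sum_le_sum fun j _ => (measure_union_le _ _).trans ?_
          rw [two_mul, ENNReal.ofReal_add (Real.exp_pos _).le (Real.exp_pos _).le]
          exact add_le_add (hpos j) (hneg j)
      _ = _ := by
          rw [Finset.sum_const, Finset.card_univ, nsmul_eq_mul, ← ENNReal.ofReal_natCast,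
            ← ENNReal.ofReal_mul (Nat.cast_nonneg _)]
          congr 1; ring
  · simp only [Set.mem_iUnion, Set.mem_union, Set.mem_ofPred_eq, not_exists, not_or, not_le,
      score_neg] at hy
    have hj : ∀ j, score b X' y θ' (g j) ^ 2 ≤ t ^ 2 := fun j => by
      apply sq_le_sq'
      · linarith [(hy j).2]
      · exact (hy j).1.le
    conv_lhs => rw [hexpand v, score_sum]
    have hq : v ⬝ᵥ (fisher b X' θ' *ᵥ v) = ∑ j, (G *ᵥ v) j ^ 2 := by
      rw [hG, dotProduct_gram_mulVec, dotProduct]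
      simp only [pow_two]
    rw [hq]
    refine (Finset.sum_mul_sq_le_sq_mul_sq _ _ _).trans ?_
    rw [mul_comm]
    refine mul_le_mul_of_nonneg_right ?_ (Finset.sum_nonneg fun j _ => sq_nonneg _)
    calc _ ≤ ∑ _j : ι, t ^ 2 := Finset.sum_le_sum fun j _ => hj j
      _ = _ := by simp

/-- A maximizer outside the Fisher ball of radius `3 Cdev R` would, by concavity, make the
log-likelihood on the sphere at least as large as at the centre, against the expansion there. -/
theorem IsFamily.mle_localization [DecidableEq ι] (h : IsFamily b k μ Cdev)
    {X : Matrix (Fin n) ι ℝ} {θ : ι → ℝ} (hX : Function.Injective (X *ᵥ ·)) {z : ℝ}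
    (hz : ∀ i, X i ⬝ᵥ ((fisher b X θ)⁻¹ *ᵥ X i) ≤ z) {y : Fin n → ℝ} {R : ℝ} (hR : 0 < R)
    (hscore : ∀ v, score b X y θ v ^ 2 ≤ R ^ 2 * (v ⬝ᵥ (fisher b X θ *ᵥ v)))
    (hRz : z * (3 * Cdev * R) ^ 2 ≤ 1 / 4) {θm : ι → ℝ} (hm : IsMLE b k X y θm) (i : Fin n) :
    |(X *ᵥ (θm - θ)) i| ≤ 1 / 2 := by
  have hF := h.fisher_posDef hX θ
  have hC : 0 < Cdev := by linarith [h.one_le]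
  set r := 3 * Cdev * R with hr
  have hr0 : 0 < r := by positivity
  refine abs_mulVec_le hF hz (q := r ^ 2) ?_ hRz i
  by_contra! hlt
  set v := θm - θ with hv
  set q := v ⬝ᵥ (fisher b X θ *ᵥ v) with hq
  have hq0 : 0 < q := (by positivity : 0 < r ^ 2).trans hlt
  set τ := r / √q with hτ
  have hsq := Real.sqrt_pos.2 hq0
  have hτ0 : 0 < τ := by positivity
  have hτ1 : τ ≤ 1 := by
    rw [hτ, div_le_one hsq]
    exact Real.le_sqrt_of_sq_le hlt.le
  have hu : (τ • v) ⬝ᵥ (fisher b X θ *ᵥ (τ • v)) = r ^ 2 := by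
    rw [Matrix.mulVec_smul, dotProduct_smul, smul_dotProduct, ← hq, smul_eq_mul, smul_eq_mul,
      hτ, ← mul_assoc, ← pow_two, div_pow, Real.sq_sqrt hq0.le]
    field_simp
  have hsmall := abs_mulVec_le hF hz hu.le hRz
  have hupper := h.logLik_add_sub_le X y θ hsmall
  rw [hu] at hupper
  have hs : score b X y θ (τ • v) ≤ R * r := by
    refine abs_le_of_sq_le_sq' ?_ (by positivity) |>.2
    calc _ ≤ R ^ 2 * ((τ • v) ⬝ᵥ (fisher b X θ *ᵥ (τ • v))) := hscore _
      _ = (R * r) ^ 2 := by rw [hu]; ring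
  have hneg : R * r - Cdev⁻¹ / 2 * r ^ 2 < 0 := by
    have : Cdev⁻¹ / 2 * r ^ 2 = 3 / 2 * R * r := by
      rw [pow_two, ← mul_assoc]; congr 1; rw [hr]; field_simp
    rw [this]; nlinarith [mul_pos hR hr0]
  have hconc : τ * (logLik b k X y θm - logLik b k X y θ)
      ≤ logLik b k X y (θ + τ • v) - logLik b k X y θ := by
    rw [logLik_diff, logLik_diff, Finset.mul_sum]
    refine Finset.sum_le_sum fun i _ => ?_
    have := h.strictConvex.convexOn.2 (Set.mem_univ ((X *ᵥ θ) i)) (Set.mem_univ ((X *ᵥ θm) i))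
      (sub_nonneg.2 hτ1) hτ0.le (by ring)
    simp only [smul_eq_mul] at this
    have e : (X *ᵥ (θ + τ • v)) i = (1 - τ) * (X *ᵥ θ) i + τ * (X *ᵥ θm) i := by
      rw [hv, Matrix.mulVec_add, Matrix.mulVec_smul, Matrix.mulVec_sub]
      simp only [Pi.add_apply, Pi.smul_apply, Pi.sub_apply, smul_eq_mul]
      ring
    rw [e]
    linarith
  have := mul_nonneg hτ0.le (sub_nonneg.2 (hm θ))
  linarith

/-- Lower bound for the fractional likelihood integrated against the slab of the true model, given
that the maximum likelihood estimator is close to the truth on every row of the design. -/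
theorem IsFamily.le_lintegral_slab [DecidableEq ι] (h : IsFamily b k μ Cdev)
    {X : Matrix (Fin n) ι ℝ} {θ : ι → ℝ} (hX : Function.Injective (X *ᵥ ·)) {z : ℝ}
    (hz : ∀ i, X i ⬝ᵥ ((fisher b X θ)⁻¹ *ᵥ X i) ≤ z)
    (hcard : z * (Cdev * Fintype.card ι) ≤ 1 / 4) {y : Fin n → ℝ} {θm : ι → ℝ}
    (hm : IsMLE b k X y θm) (hclose : ∀ i, |(X *ᵥ (θm - θ)) i| ≤ 1 / 2) {α c : ℝ} (hα : 0 ≤ α)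
    (hc : 0 < c) :
    ENNReal.ofReal ((Real.exp (-(α * Cdev / 2)) * (√c * (2 / √(2 * Real.pi)) *
        Real.exp (-(c / 2)))) ^ Fintype.card ι)
      ≤ ∫⁻ x, ENNReal.ofReal (Real.exp (α * (logLik b k X y x - logLik b k X y θ))
          * gaussian θm (c • fisher b X θm) x) := by
  have hF := h.fisher_posDef hX θ
  have hFm := h.fisher_posDef hX θm
  have hC : 0 < Cdev := by linarith [h.one_le]
  have hcomp : ∀ v, v ⬝ᵥ (fisher b X θ *ᵥ v) ≤ Cdev * (v ⬝ᵥ (fisher b X θm *ᵥ v)) := fun v => by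
    rw [fisher_quadratic, fisher_quadratic, Finset.mul_sum]
    refine Finset.sum_le_sum fun i _ => ?_
    rw [← mul_assoc]
    refine mul_le_mul_of_nonneg_right (h.deriv2_le ?_) (sq_nonneg _)
    have := hclose i
    rwa [Matrix.mulVec_sub, Pi.sub_apply, abs_sub_comm] at this
  set U := {x : ι → ℝ | (x - θm) ⬝ᵥ (fisher b X θm *ᵥ (x - θm)) ≤ Fintype.card ι} with hU
  have hUm : MeasurableSet U := by
    refine measurableSet_le ?_ measurable_const
    unfold dotProduct mulVec dotProduct
    fun_prop
  rw [mul_pow, ENNReal.ofReal_mul (by positivity)]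
  calc _ ≤ ENNReal.ofReal (Real.exp (-(α * Cdev / 2)) ^ Fintype.card ι) *
        ∫⁻ x in U, ENNReal.ofReal (gaussian θm (c • fisher b X θm) x) :=
        mul_le_mul_right (le_setLIntegral_gaussian θm hFm hc) _
    _ = ∫⁻ x in U, ENNReal.ofReal (Real.exp (-(α * Cdev / 2)) ^ Fintype.card ι) *
          ENNReal.ofReal (gaussian θm (c • fisher b X θm) x) :=
        (lintegral_const_mul' _ _ ENNReal.ofReal_ne_top).symm
    _ ≤ ∫⁻ x in U, ENNReal.ofReal (Real.exp (α * (logLik b k X y x - logLik b k X y θ))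
          * gaussian θm (c • fisher b X θm) x) := by
        refine setLIntegral_mono' hUm fun x hx => ?_
        have hx' : (x - θm) ⬝ᵥ (fisher b X θm *ᵥ (x - θm)) ≤ Fintype.card ι := hx
        rw [ENNReal.ofReal_mul (Real.exp_pos _).le]
        refine mul_le_mul_left (ENNReal.ofReal_le_ofReal ?_) _
        rw [← Real.exp_nat_mul]
        refine Real.exp_le_exp.2 ?_
        have hsmall := abs_mulVec_le hF hz (v := x - θm) (q := Cdev * Fintype.card ι)
          ((hcomp _).trans (mul_le_mul_of_nonneg_left hx' hC.le)) hcard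
        have h1 := h.le_logLik_add_sub X y θm hsmall
        rw [h.score_eq_zero hm, add_sub_cancel] at h1
        have h2 := hm θ
        have h3 : -(Cdev / 2 * Fintype.card ι) ≤ logLik b k X y x - logLik b k X y θ := by
          nlinarith
        calc _ = α * -(Cdev / 2 * Fintype.card ι) := by ring
          _ ≤ _ := mul_le_mul_of_nonneg_left h3 hα
    _ ≤ _ := setLIntegral_le_lintegral _ _

end Score

/-! ### Submodels, and measurability in the data -/

section Submodel

variable {n p : ℕ}

theorem mulVec_embed (X : Matrix (Fin n) (Fin p) ℝ) (S : Finset (Fin p)) (θ : S → ℝ) :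
    X *ᵥ embed S θ = cols X S *ᵥ θ := by
  funext i
  change ∑ j, X i j * embed S θ j = ∑ j : S, X i j * θ j
  rw [← Finset.sum_subset (Finset.subset_univ S) fun j _ hj => by simp [embed, hj],
    ← Finset.sum_coe_sort S fun j => X i j * embed S θ j]
  exact Finset.sum_congr rfl fun j _ => by simp [embed]

theorem logLik_embed (X : Matrix (Fin n) (Fin p) ℝ) (y : Fin n → ℝ) (S : Finset (Fin p))
    (θ : S → ℝ) : logLik b k X y (embed S θ) = logLik b k (cols X S) y θ := by
  simp only [logLik, mulVec_embed]

theorem embed_supp (θ : Fin p → ℝ) : embed (supp θ) (fun j => θ j) = θ := by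
  funext j
  by_cases hj : θ j = 0 <;> simp [embed, supp, hj]

theorem measurable_embed (S : Finset (Fin p)) : Measurable (embed S) := by
  refine measurable_pi_lambda _ fun j => ?_
  unfold embed
  split_ifs with hj
  · exact measurable_pi_apply _
  · exact measurable_const

theorem IsFamily.slab_eq (h : IsFamily b k μ Cdev) {X : Matrix (Fin n) (Fin p) ℝ}
    {S : Finset (Fin p)} (hS : Function.Injective (cols X S *ᵥ ·)) {lam : ℝ} (hlam : 0 < lam)
    (y : Fin n → ℝ) (θ : S → ℝ) :
    slab b k X lam y S θ = gaussian (mle b k (cols X S) y)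
      (lam • fisher b (cols X S) (mle b k (cols X S) y)) θ :=
  normalDensity_inv_eq _ ((h.fisher_posDef hS _).smul hlam) _

theorem measurable_normalDensity {ι : Type} [Fintype ι] [DecidableEq ι] (m : ι → ℝ)
    (V : Matrix ι ι ℝ) : Measurable (normalDensity m V) := by
  unfold normalDensity dotProduct mulVec dotProduct
  fun_prop

/-- Prior mass of a single support. -/
noncomputable def supportMass (w : ℕ → ℝ) (S : Finset (Fin p)) : ℝ :=
  w S.card / (p.choose S.card : ℝ)

theorem lintegral_prior (X : Matrix (Fin n) (Fin p) ℝ) (w : ℕ → ℝ) (lam : ℝ) (y : Fin n → ℝ)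
    {f : (Fin p → ℝ) → ENNReal} (hf : Measurable f) :
    ∫⁻ θ, f θ ∂(prior b k X w lam y) = ∑ S : Finset (Fin p), ENNReal.ofReal (supportMass w S) *
      ∫⁻ θ : S → ℝ, ENNReal.ofReal (slab b k X lam y S θ) * f (embed S θ) := by
  rw [prior, lintegral_finsetSum_measure]
  refine Finset.sum_congr rfl fun S _ => ?_
  have hslab : Measurable fun θ => ENNReal.ofReal (slab b k X lam y S θ) :=
    (measurable_normalDensity _ _).ennreal_ofReal
  rw [lintegral_smul_measure, lintegral_map hf (measurable_embed S)]
  exact congrArg (_ * ·)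
    (lintegral_withDensity_eq_lintegral_mul _ hslab (hf.comp (measurable_embed S)))

theorem continuous_gaussian {ι : Type} [Fintype ι] [DecidableEq ι] {T : Type*}
    [TopologicalSpace T] {m x : T → ι → ℝ} {A : T → Matrix ι ι ℝ} (hm : Continuous m)
    (hA : Continuous A) (hx : Continuous x) : Continuous fun t => gaussian (m t) (A t) (x t) := by
  unfold gaussian
  refine (continuous_const.mul hA.matrix_det.sqrt).mul (Real.continuous_exp.comp
    (continuous_const.mul ((hx.sub hm).dotProduct (hA.matrix_mulVec (hx.sub hm)))))

theorem IsFamily.measurable_gaussian_fisher {ι : Type} [Fintype ι] [DecidableEq ι]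
    (h : IsFamily b k μ Cdev) {X : Matrix (Fin n) ι ℝ} (hX : Function.Injective (X *ᵥ ·)) (c : ℝ) :
    Measurable fun q : (Fin n → ℝ) × (ι → ℝ) =>
      gaussian (mle b k X q.1) (c • fisher b X (mle b k X q.1)) q.2 := by
  have hc : Continuous fun q : (ι → ℝ) × (ι → ℝ) => gaussian q.1 (c • fisher b X q.1) q.2 :=
    continuous_gaussian continuous_fst
      (((h.continuous_fisher _).comp continuous_fst).const_smul c) continuous_snd
  have hm : Measurable fun q : (Fin n → ℝ) × (ι → ℝ) => (mle b k X q.1, q.2) :=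
    ((h.measurable_mle hX).comp measurable_fst).prodMk measurable_snd
  have := hc.measurable.comp hm
  simp only [Function.comp_def] at this
  exact this

theorem IsFamily.measurable_slab (h : IsFamily b k μ Cdev) {X : Matrix (Fin n) (Fin p) ℝ}
    {S : Finset (Fin p)} (hS : Function.Injective (cols X S *ᵥ ·)) {lam : ℝ} (hlam : 0 < lam) :
    Measurable fun q : (Fin n → ℝ) × (S → ℝ) => slab b k X lam q.1 S q.2 :=
  (funext fun q => h.slab_eq hS hlam q.1 q.2 :
    (fun q : (Fin n → ℝ) × (S → ℝ) => slab b k X lam q.1 S q.2) = _) ▸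
      h.measurable_gaussian_fisher hS lam

theorem IsFamily.measurable_logLik (h : IsFamily b k μ Cdev) (X : Matrix (Fin n) (Fin p) ℝ) :
    Measurable fun q : (Fin n → ℝ) × (Fin p → ℝ) => logLik b k X q.1 q.2 := by
  have hb := h.continuous_b.measurable
  have hk := h.measurable_k
  unfold logLik logDensity mulVec dotProduct
  fun_prop

theorem IsFamily.measurable_lintegral_prior (h : IsFamily b k μ Cdev)
    {X : Matrix (Fin n) (Fin p) ℝ} {smax : ℕ}
    (hinj : ∀ S : Finset (Fin p), S.card ≤ smax → Function.Injective (cols X S *ᵥ ·))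
    {w : ℕ → ℝ} (hw : ∀ s, smax < s → w s = 0) {lam : ℝ} (hlam : 0 < lam)
    {f : (Fin n → ℝ) → (Fin p → ℝ) → ENNReal} (hf : Measurable (Function.uncurry f)) :
    Measurable fun y => ∫⁻ θ, f y θ ∂(prior b k X w lam y) := by
  have e : (fun y => ∫⁻ θ, f y θ ∂(prior b k X w lam y)) = fun y =>
      ∑ S : Finset (Fin p), ENNReal.ofReal (supportMass w S) *
        ∫⁻ θ : S → ℝ, ENNReal.ofReal (slab b k X lam y S θ) * f y (embed S θ) :=
    funext fun y => lintegral_prior X w lam y (hf.comp measurable_prodMk_left)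
  rw [e]
  refine Finset.measurable_fun_sum _ fun S _ => ?_
  by_cases hS : S.card ≤ smax
  · refine Measurable.const_mul ?_ _
    refine Measurable.lintegral_prod_right' (f := fun q : (Fin n → ℝ) × (S → ℝ) =>
      ENNReal.ofReal (slab b k X lam q.1 S q.2) * f q.1 (embed S q.2)) ?_
    refine ((h.measurable_slab (hinj S hS) hlam).ennreal_ofReal).mul ?_
    exact hf.comp (measurable_fst.prodMk ((measurable_embed S).comp measurable_snd))
  · simp [supportMass, hw _ (not_le.1 hS)]

theorem IsFamily.measurable_posterior (h : IsFamily b k μ Cdev)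
    {X : Matrix (Fin n) (Fin p) ℝ} {smax : ℕ}
    (hinj : ∀ S : Finset (Fin p), S.card ≤ smax → Function.Injective (cols X S *ᵥ ·))
    {w : ℕ → ℝ} (hw : ∀ s, smax < s → w s = 0) {lam : ℝ} (hlam : 0 < lam) (α : ℝ)
    {A : Set (Fin p → ℝ)} (hA : MeasurableSet A) :
    Measurable fun y => posterior b k X w lam α y A := by
  have hL : Measurable (Function.uncurry fun (y : Fin n → ℝ) (θ : Fin p → ℝ) =>
      ENNReal.ofReal (Real.exp (α * logLik b k X y θ))) :=
    (Real.measurable_exp.comp ((h.measurable_logLik X).const_mul α)).ennreal_ofReal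
  unfold posterior
  refine Measurable.ennreal_toReal (Measurable.div ?_
    (h.measurable_lintegral_prior hinj hw hlam hL))
  simp_rw [← lintegral_indicator hA]
  exact h.measurable_lintegral_prior hinj hw hlam (f := fun y => A.indicator fun θ =>
    ENNReal.ofReal (Real.exp (α * logLik b k X y θ))) (hL.indicator (measurable_snd hA))

theorem posterior_nonneg (X : Matrix (Fin n) (Fin p) ℝ) (w : ℕ → ℝ) (lam α : ℝ)
    (y : Fin n → ℝ) (A : Set (Fin p → ℝ)) : 0 ≤ posterior b k X w lam α y A :=
  ENNReal.toReal_nonneg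

theorem posterior_ratio_le_one (X : Matrix (Fin n) (Fin p) ℝ) (w : ℕ → ℝ) (lam α : ℝ)
    (y : Fin n → ℝ) (A : Set (Fin p → ℝ)) :
    (∫⁻ θ in A, ENNReal.ofReal (Real.exp (α * logLik b k X y θ)) ∂(prior b k X w lam y)) /
      (∫⁻ θ, ENNReal.ofReal (Real.exp (α * logLik b k X y θ)) ∂(prior b k X w lam y)) ≤ 1 :=
  ENNReal.div_le_of_le_mul (by rw [one_mul]; exact setLIntegral_le_lintegral _ _)

theorem IsFamily.measurableSet_hellinger_lt (h : IsFamily b k μ Cdev)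
    (X : Matrix (Fin n) (Fin p) ℝ) (θ₀ : Fin p → ℝ) (c : ℝ) :
    MeasurableSet {θ | c < meanHellinger b k μ X θ θ₀} := by
  refine measurableSet_lt measurable_const (Continuous.measurable ?_)
  unfold meanHellinger
  refine (continuous_const.mul (continuous_finsetSum _ fun i _ =>
    (h.continuous_hellingerSq _).comp ?_)).sqrt
  unfold mulVec dotProduct
  fun_prop

theorem isClosed_posSemidef {ι : Type} [Fintype ι] :
    IsClosed {A : Matrix ι ι ℝ | A.PosSemidef} := by
  have e : {A : Matrix ι ι ℝ | A.PosSemidef} =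
      {A | Aᴴ = A} ∩ ⋂ x : ι → ℝ, {A | 0 ≤ star x ⬝ᵥ (A *ᵥ x)} := by
    ext A
    simp only [Matrix.posSemidef_iff_dotProduct_mulVec, Matrix.IsHermitian, Set.mem_ofPred_eq,
      Set.mem_inter_iff, Set.mem_iInter]
  rw [e]
  refine (isClosed_eq continuous_id.matrix_conjTranspose continuous_id).inter
    (isClosed_iInter fun x => isClosed_le continuous_const ?_)
  exact continuous_const.dotProduct (continuous_id.matrix_mulVec continuous_const)

theorem IsFamily.measurableSet_mleEvent (h : IsFamily b k μ Cdev)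
    {X : Matrix (Fin n) (Fin p) ℝ} {smax : ℕ}
    (hinj : ∀ S : Finset (Fin p), S.card ≤ smax → Function.Injective (cols X S *ᵥ ·))
    (D : ℝ) (θbar : ∀ S : Finset (Fin p), S → ℝ) :
    MeasurableSet (mleEvent b k X smax D θbar) := by
  have e : mleEvent b k X smax D θbar = ⋂ S : Finset (Fin p), ⋂ _ : S.card ≤ smax,
      ({y | ∃ θ, IsMLE b k (cols X S) y θ} ∩ (fun y => mle b k (cols X S) y) ⁻¹'
        {m | (fisher b (cols X S) m - D⁻¹ • fisher b (cols X S) (θbar S)).PosSemidef ∧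
          (D • fisher b (cols X S) (θbar S) - fisher b (cols X S) m).PosSemidef ∧
          (m - θbar S) ⬝ᵥ (fisher b (cols X S) (θbar S) *ᵥ (m - θbar S))
            ≤ D * S.card * Real.log p}) := by
    ext y
    simp only [mleEvent, Set.mem_ofPred_eq, Set.mem_iInter, Set.mem_inter_iff, Set.mem_preimage]
  rw [e]
  refine MeasurableSet.iInter fun S => MeasurableSet.iInter fun hS =>
    (h.measurableSet_exists_isMLE (hinj S hS)).inter (h.measurable_mle (hinj S hS) ?_)
  have hF := h.continuous_fisher (cols X S)
  refine IsClosed.measurableSet (IsClosed.inter ?_ (IsClosed.inter ?_ ?_))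
  · exact isClosed_posSemidef.preimage (hF.sub continuous_const)
  · exact isClosed_posSemidef.preimage (continuous_const.sub hF)
  · have hsub : Continuous fun m : S → ℝ => m - θbar S := continuous_id.sub continuous_const
    exact isClosed_le (hsub.dotProduct (continuous_const.matrix_mulVec hsub)) continuous_const

end Submodel

/-! ### The fractional posterior at a fixed sample size -/

section FixedSample

variable {n p : ℕ}

theorem sum_supportMass_mul_pow (w : ℕ → ℝ) (a : ℝ) :
    ∑ S : Finset (Fin p), supportMass w S * a ^ S.card
      = ∑ s ∈ Finset.range (p + 1), w s * a ^ s := by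
  have h1 := Finset.sum_powerset_apply_card (x := (Finset.univ : Finset (Fin p)))
    (fun s => w s / (p.choose s : ℝ) * a ^ s)
  rw [Finset.powerset_univ, Finset.card_univ, Fintype.card_fin] at h1
  refine h1.trans (Finset.sum_congr rfl fun s hs => ?_)
  have : (p.choose s : ℝ) ≠ 0 := by
    exact_mod_cast (Nat.choose_pos (Nat.lt_succ_iff.1 (Finset.mem_range.1 hs))).ne'
  rw [nsmul_eq_mul]
  field_simp

theorem supportMass_nonneg {w : ℕ → ℝ} (hw : ∀ s, 0 ≤ w s) (S : Finset (Fin p)) :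
    0 ≤ supportMass w S := div_nonneg (hw _) (Nat.cast_nonneg _)

/-- On the event on which the model-wise estimators concentrate, the data-dependent slab is
dominated by a fixed normal density. -/
theorem IsFamily.slab_le (h : IsFamily b k μ Cdev) {X : Matrix (Fin n) (Fin p) ℝ} {smax : ℕ}
    (hinj : ∀ S : Finset (Fin p), S.card ≤ smax → Function.Injective (cols X S *ᵥ ·))
    {lam D : ℝ} (hlam : 0 < lam) (hD : 0 < D) {θbar : ∀ S : Finset (Fin p), S → ℝ}
    {y : Fin n → ℝ} (hy : y ∈ mleEvent b k X smax D θbar) {S : Finset (Fin p)}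
    (hS : S.card ≤ smax) (θ : S → ℝ) :
    slab b k X lam y S θ ≤ (√2 * D * Real.exp (lam * Real.log p / 2)) ^ S.card *
      gaussian (θbar S) ((lam / (2 * D)) • fisher b (cols X S) (θbar S)) θ := by
  obtain ⟨-, h1, h2, h3⟩ := hy S hS
  rw [h.slab_eq (hinj S hS) hlam]
  refine (gaussian_le_gaussian _ _ (h.fisher_posDef (hinj S hS) _)
    (h.fisher_posDef (hinj S hS) _) hD hlam h1 h2
    (h3.trans_eq (mul_assoc D (S.card : ℝ) (Real.log p))) θ).trans (le_of_eq ?_)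
  rw [Fintype.card_coe, mul_pow (√2 * D), ← Real.exp_nat_mul]
  congr 3; ring

/-- The numerator of the fractional posterior, normalized by the likelihood of `θ₀`, has small
mean on the concentration event. -/
theorem IsFamily.lintegral_numerator_le (h : IsFamily b k μ Cdev) {α : ℝ}
    (hα : α ∈ Set.Ioo (0 : ℝ) 1) (hn : n ≠ 0) {X : Matrix (Fin n) (Fin p) ℝ} (θ₀ : Fin p → ℝ)
    {smax : ℕ}
    (hinj : ∀ S : Finset (Fin p), S.card ≤ smax → Function.Injective (cols X S *ᵥ ·))
    {w : ℕ → ℝ} (hw : ∀ s, 0 ≤ w s) (hw0 : ∀ s, smax < s → w s = 0)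
    {lam D : ℝ} (hlam : 0 < lam) (hD : 0 < D) (θbar : ∀ S : Finset (Fin p), S → ℝ)
    {A : Set (Fin p → ℝ)} (hA : MeasurableSet A) {r : ℝ}
    (hAr : ∀ θ ∈ A, r ≤ n * meanHellinger b k μ X θ θ₀ ^ 2) :
    ∫⁻ y in mleEvent b k X smax D θbar, ENNReal.ofReal (Real.exp (-(α * logLik b k X y θ₀))) *
        ∫⁻ θ in A, ENNReal.ofReal (Real.exp (α * logLik b k X y θ)) ∂(prior b k X w lam y)
        ∂(law b k μ X θ₀)
      ≤ ENNReal.ofReal ((∑ S : Finset (Fin p), supportMass w S *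
          (√2 * D * Real.exp (lam * Real.log p / 2)) ^ S.card) *
          Real.exp (-(min α (1 - α) * r))) := by
  have hprob := h.isProbabilityMeasure_law X θ₀
  set a := √2 * D * Real.exp (lam * Real.log p / 2) with ha
  have ha0 : 0 ≤ a := by positivity
  have hc : 0 ≤ min α (1 - α) := le_min hα.1.le (by linarith [hα.2])
  have hE := h.measurableSet_mleEvent hinj D θbar
  have hLm := h.measurable_logLik X
  have hLy : ∀ θ, Measurable fun y => logLik b k X y θ := fun θ =>
    hLm.comp (measurable_id.prodMk measurable_const)
  set R : (Fin n → ℝ) → (Fin p → ℝ) → ENNReal := fun y => A.indicator fun θ =>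
    ENNReal.ofReal (Real.exp (α * (logLik b k X y θ - logLik b k X y θ₀))) with hR
  have hRm : Measurable (Function.uncurry R) := by
    have : Measurable (Function.uncurry fun (y : Fin n → ℝ) (θ : Fin p → ℝ) =>
        ENNReal.ofReal (Real.exp (α * (logLik b k X y θ - logLik b k X y θ₀)))) :=
      (Real.measurable_exp.comp ((hLm.sub ((hLy θ₀).comp measurable_fst)).const_mul
        α)).ennreal_ofReal
    exact this.indicator (measurable_snd hA)
  set g : ∀ S : Finset (Fin p), (S → ℝ) → ℝ := fun S =>
    gaussian (θbar S) ((lam / (2 * D)) • fisher b (cols X S) (θbar S)) with hg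
  have hjoint : ∀ S : Finset (Fin p), Measurable fun q : (Fin n → ℝ) × (S → ℝ) =>
      ENNReal.ofReal (g S q.2) * R q.1 (embed S q.2) := fun S =>
    ((measurable_gaussian _ _).comp measurable_snd).ennreal_ofReal.mul
      (hRm.comp (measurable_fst.prodMk ((measurable_embed S).comp measurable_snd)))
  set I : Finset (Fin p) → (Fin n → ℝ) → ENNReal := fun S y =>
    ∫⁻ θ : S → ℝ, ENNReal.ofReal (g S θ) * R y (embed S θ) with hI
  have hpoint : ∀ y ∈ mleEvent b k X smax D θbar,
      ENNReal.ofReal (Real.exp (-(α * logLik b k X y θ₀))) *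
        ∫⁻ θ in A, ENNReal.ofReal (Real.exp (α * logLik b k X y θ)) ∂(prior b k X w lam y)
      ≤ ∑ S : Finset (Fin p), ENNReal.ofReal (supportMass w S * a ^ S.card) * I S y := by
    intro y hy
    have e1 : ENNReal.ofReal (Real.exp (-(α * logLik b k X y θ₀))) *
        ∫⁻ θ in A, ENNReal.ofReal (Real.exp (α * logLik b k X y θ)) ∂(prior b k X w lam y)
        = ∫⁻ θ, R y θ ∂(prior b k X w lam y) := by
      rw [hR, lintegral_indicator hA, ← lintegral_const_mul' _ _ ENNReal.ofReal_ne_top]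
      refine lintegral_congr fun θ => ?_
      rw [← ENNReal.ofReal_mul (Real.exp_pos _).le, ← Real.exp_add]
      congr 2; ring
    rw [e1, lintegral_prior X w lam y (f := R y) (hRm.comp measurable_prodMk_left)]
    refine Finset.sum_le_sum fun S _ => ?_
    by_cases hS : S.card ≤ smax
    · rw [ENNReal.ofReal_mul (supportMass_nonneg hw S), mul_assoc]
      refine mul_le_mul_right ?_ _
      rw [← lintegral_const_mul' _ _ ENNReal.ofReal_ne_top]
      refine lintegral_mono fun θ => ?_
      rw [← mul_assoc, ← ENNReal.ofReal_mul (by positivity)]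
      exact mul_le_mul_left (ENNReal.ofReal_le_ofReal (h.slab_le hinj hlam hD hy hS θ)) _
    · simp [supportMass, hw0 _ (not_le.1 hS)]
  have hmean : ∀ S : Finset (Fin p), S.card ≤ smax →
      ∫⁻ y, I S y ∂(law b k μ X θ₀)
        ≤ ENNReal.ofReal (Real.exp (-(min α (1 - α) * r))) := by
    intro S hS
    rw [hI, lintegral_lintegral_swap (hjoint S).aemeasurable]
    calc _ ≤ ∫⁻ θ : S → ℝ, ENNReal.ofReal (g S θ) *
          ENNReal.ofReal (Real.exp (-(min α (1 - α) * r))) := by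
          refine lintegral_mono fun θ => ?_
          rw [lintegral_const_mul' _ _ ENNReal.ofReal_ne_top]
          refine mul_le_mul_right ?_ _
          by_cases hθ : embed S θ ∈ A
          · simp only [hR, Set.indicator_of_mem hθ]
            refine (h.lintegral_likelihoodRatio_le hα hn X _ θ₀).trans
              (ENNReal.ofReal_le_ofReal (Real.exp_le_exp.2 (neg_le_neg ?_)))
            exact mul_le_mul_of_nonneg_left (hAr _ hθ) hc
          · simp [hR, Set.indicator_of_notMem hθ]
      _ = _ := by
          rw [lintegral_mul_const' _ _ ENNReal.ofReal_ne_top, hg, lintegral_gaussian _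
            ((h.fisher_posDef (hinj S hS) _).smul (by positivity)), one_mul]
  calc _ ≤ ∫⁻ y in mleEvent b k X smax D θbar, ∑ S : Finset (Fin p),
          ENNReal.ofReal (supportMass w S * a ^ S.card) * I S y ∂(law b k μ X θ₀) :=
        setLIntegral_mono' hE hpoint
    _ ≤ ∫⁻ y, ∑ S : Finset (Fin p), ENNReal.ofReal (supportMass w S * a ^ S.card) * I S y
          ∂(law b k μ X θ₀) :=
        setLIntegral_le_lintegral _ _
    _ = ∑ S : Finset (Fin p), ENNReal.ofReal (supportMass w S * a ^ S.card) *
          ∫⁻ y, I S y ∂(law b k μ X θ₀) := by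
        rw [lintegral_finsetSum _ fun S _ => ((hjoint S).lintegral_prod_right').const_mul _]
        exact Finset.sum_congr rfl fun S _ => lintegral_const_mul' _ _ ENNReal.ofReal_ne_top
    _ ≤ ∑ S : Finset (Fin p), ENNReal.ofReal (supportMass w S * a ^ S.card) *
          ENNReal.ofReal (Real.exp (-(min α (1 - α) * r))) := by
        refine Finset.sum_le_sum fun S _ => ?_
        by_cases hS : S.card ≤ smax
        · exact mul_le_mul_right (hmean S hS) _
        · simp [supportMass, hw0 _ (not_le.1 hS)]
    _ = _ := by
        rw [← Finset.sum_mul, ← ENNReal.ofReal_sum_of_nonneg fun S _ =>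
          mul_nonneg (supportMass_nonneg hw S) (by positivity),
          ← ENNReal.ofReal_mul (Finset.sum_nonneg fun S _ =>
            mul_nonneg (supportMass_nonneg hw S) (by positivity))]

/-- The denominator of the fractional posterior is bounded from below by the contribution of the
true support. -/
theorem IsFamily.le_denominator (h : IsFamily b k μ Cdev) {α : ℝ} (hα : 0 ≤ α)
    {X : Matrix (Fin n) (Fin p) ℝ} {θ₀ : Fin p → ℝ}
    (hinj : Function.Injective (cols X (supp θ₀) *ᵥ ·)) {w : ℕ → ℝ} (hw : ∀ s, 0 ≤ w s)
    {lam : ℝ} (hlam : 0 < lam) {y : Fin n → ℝ} {z : ℝ}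
    (hz : ∀ i, cols X (supp θ₀) i ⬝ᵥ
      ((fisher b (cols X (supp θ₀)) (fun j => θ₀ j))⁻¹ *ᵥ cols X (supp θ₀) i) ≤ z)
    (hcard : z * (Cdev * (supp θ₀).card) ≤ 1 / 4)
    (hm : IsMLE b k (cols X (supp θ₀)) y (mle b k (cols X (supp θ₀)) y))
    (hclose : ∀ i, |(cols X (supp θ₀) *ᵥ
      (mle b k (cols X (supp θ₀)) y - fun j : supp θ₀ => θ₀ j)) i| ≤ 1 / 2) :
    ENNReal.ofReal (Real.exp (α * logLik b k X y θ₀)) *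
        ENNReal.ofReal (supportMass w (supp θ₀) * (Real.exp (-(α * Cdev / 2)) *
          (√lam * (2 / √(2 * Real.pi)) * Real.exp (-(lam / 2)))) ^ (supp θ₀).card)
      ≤ ∫⁻ θ, ENNReal.ofReal (Real.exp (α * logLik b k X y θ)) ∂(prior b k X w lam y) := by
  set S := supp θ₀ with hS
  have hL0 : logLik b k X y θ₀ = logLik b k (cols X S) y (fun j => θ₀ j) := by
    rw [← logLik_embed, hS, embed_supp]
  have hfm : Measurable fun θ => ENNReal.ofReal (Real.exp (α * logLik b k X y θ)) :=
    (Real.measurable_exp.comp (((h.measurable_logLik X).comp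
      measurable_prodMk_left).const_mul α)).ennreal_ofReal
  rw [lintegral_prior X w lam y hfm]
  refine le_trans ?_ (Finset.single_le_sum
    (f := fun S : Finset (Fin p) => ENNReal.ofReal (supportMass w S) * ∫⁻ θ : S → ℝ,
      ENNReal.ofReal (slab b k X lam y S θ) *
        ENNReal.ofReal (Real.exp (α * logLik b k X y (embed S θ))))
    (fun _ _ => zero_le) (Finset.mem_univ S))
  have key := h.le_lintegral_slab hinj hz (by rwa [Fintype.card_coe]) hm hclose hα hlam
  rw [Fintype.card_coe] at key
  rw [ENNReal.ofReal_mul (supportMass_nonneg hw S), mul_left_comm]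
  refine mul_le_mul_right ?_ _
  calc _ ≤ _ := mul_le_mul_right key _
    _ = _ := by
        rw [← lintegral_const_mul' _ _ ENNReal.ofReal_ne_top]
        refine lintegral_congr fun θ => ?_
        rw [h.slab_eq hinj hlam, ← ENNReal.ofReal_mul (Real.exp_pos _).le,
          ← ENNReal.ofReal_mul (gaussian_nonneg _ _ _), logLik_embed, hL0, ← mul_assoc,
          ← Real.exp_add, mul_comm]
        congr 3; ring

/-- Combination of the bounds for numerator and denominator, both normalized by the likelihood of
`θ₀`: on `E` the numerator has mean at most `u`, and on `E \ N` the denominator is at least `d`. -/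
theorem IsFamily.posterior_le (h : IsFamily b k μ Cdev) {α : ℝ}
    {X : Matrix (Fin n) (Fin p) ℝ} {θ₀ : Fin p → ℝ} {smax : ℕ}
    (hinj : ∀ S : Finset (Fin p), S.card ≤ smax → Function.Injective (cols X S *ᵥ ·))
    {w : ℕ → ℝ} (hw0 : ∀ s, smax < s → w s = 0) {lam : ℝ} (hlam : 0 < lam)
    {A : Set (Fin p → ℝ)} (hA : MeasurableSet A) {E N : Set (Fin n → ℝ)} (hE : MeasurableSet E)
    (hN : MeasurableSet N) {d u δ δ' : ℝ} (hd : 0 < d) (hu : 0 ≤ u) (hδ : 0 ≤ δ) (hδ' : 0 ≤ δ')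
    (hEδ : 1 - δ ≤ (law b k μ X θ₀).real E) (hNδ : law b k μ X θ₀ N ≤ ENNReal.ofReal δ')
    (hden : ∀ y ∈ E, y ∉ N → ENNReal.ofReal (Real.exp (α * logLik b k X y θ₀)) *
      ENNReal.ofReal d
        ≤ ∫⁻ θ, ENNReal.ofReal (Real.exp (α * logLik b k X y θ)) ∂(prior b k X w lam y))
    (hnum : ∫⁻ y in E, ENNReal.ofReal (Real.exp (-(α * logLik b k X y θ₀))) *
        ∫⁻ θ in A, ENNReal.ofReal (Real.exp (α * logLik b k X y θ)) ∂(prior b k X w lam y)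
        ∂(law b k μ X θ₀) ≤ ENNReal.ofReal u) :
    Integrable (fun y => posterior b k X w lam α y A) (law b k μ X θ₀) ∧
      ∫ y, posterior b k X w lam α y A ∂(law b k μ X θ₀) ≤ δ + δ' + u / d := by
  have hprob := h.isProbabilityMeasure_law X θ₀
  have hmeas := h.measurable_posterior hinj hw0 hlam α hA
  have hle1 : ∀ y, ENNReal.ofReal (posterior b k X w lam α y A) ≤ 1 := fun y => by
    unfold posterior
    exact ENNReal.ofReal_toReal_le.trans (posterior_ratio_le_one X w lam α y A)
  have hint : Integrable (fun y => posterior b k X w lam α y A) (law b k μ X θ₀) := by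
    refine Integrable.of_bound hmeas.aestronglyMeasurable 1 (ae_of_all _ fun y => ?_)
    rw [Real.norm_of_nonneg (posterior_nonneg _ _ _ _ _ _)]
    exact ENNReal.ofReal_le_one.1 (hle1 y)
  refine ⟨hint, ?_⟩
  set num := fun y => ∫⁻ θ in A, ENNReal.ofReal (Real.exp (α * logLik b k X y θ))
    ∂(prior b k X w lam y) with hnumdef
  have hpt : ∀ y, ENNReal.ofReal (posterior b k X w lam α y A)
      ≤ Eᶜ.indicator 1 y + (N.indicator 1 y + ENNReal.ofReal d⁻¹ * E.indicator (fun y =>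
        ENNReal.ofReal (Real.exp (-(α * logLik b k X y θ₀))) * num y) y) := by
    intro y
    by_cases hyE : y ∈ E
    · by_cases hyN : y ∈ N
      · simp only [Set.indicator_of_mem hyN, Pi.one_apply]
        exact (hle1 y).trans (le_add_left le_self_add)
      · rw [Set.indicator_of_mem hyE]
        refine le_trans ?_ (le_add_left (le_add_left le_rfl))
        unfold posterior
        refine ENNReal.ofReal_toReal_le.trans ?_
        refine (ENNReal.div_le_div_left (hden y hyE hyN) _).trans (le_of_eq ?_)
        rw [← ENNReal.ofReal_mul (Real.exp_pos _).le, div_eq_mul_inv,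
          ← ENNReal.ofReal_inv_of_pos (by positivity), mul_inv, ← Real.exp_neg,
          ENNReal.ofReal_mul (Real.exp_pos _).le, hnumdef]
        ring
    · have hyE' : y ∈ Eᶜ := hyE
      simp only [Set.indicator_of_mem hyE', Pi.one_apply]
      exact (hle1 y).trans le_self_add
  have hEc : law b k μ X θ₀ Eᶜ ≤ ENNReal.ofReal δ := by
    rw [← ofReal_measureReal (μ := law b k μ X θ₀) (s := Eᶜ), probReal_compl_eq_one_sub hE]
    exact ENNReal.ofReal_le_ofReal (by linarith)
  have htotal : ∫⁻ y, ENNReal.ofReal (posterior b k X w lam α y A) ∂(law b k μ X θ₀)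
      ≤ ENNReal.ofReal (δ + δ' + u / d) := by
    calc _ ≤ _ := lintegral_mono hpt
      _ ≤ ENNReal.ofReal δ + (ENNReal.ofReal δ' + ENNReal.ofReal d⁻¹ * ENNReal.ofReal u) := by
          rw [lintegral_add_left (measurable_one.indicator hE.compl),
            lintegral_add_left (measurable_one.indicator hN),
            lintegral_const_mul' _ _ ENNReal.ofReal_ne_top, lintegral_indicator_one hE.compl,
            lintegral_indicator_one hN, lintegral_indicator hE]
          exact add_le_add hEc (add_le_add hNδ (mul_le_mul_right hnum _))
      _ = _ := by
          have hdi : 0 ≤ d⁻¹ := inv_nonneg.2 hd.le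
          rw [← ENNReal.ofReal_mul hdi, ← ENNReal.ofReal_add hδ' (mul_nonneg hdi hu),
            ← ENNReal.ofReal_add hδ (add_nonneg hδ' (mul_nonneg hdi hu)), add_assoc,
            inv_mul_eq_div]
  rw [integral_eq_lintegral_of_nonneg_ae (ae_of_all _ fun y => posterior_nonneg _ _ _ _ _ _)
    hint.1]
  exact ENNReal.toReal_le_of_le_ofReal (by positivity) htotal

end FixedSample

/-! ### Prior on the model size -/

theorem sizePrior_le_mul_pow {w : ℕ → ℝ} {smax : ℕ} {x : ℝ} (hx : 0 ≤ x) (hw : ∀ s, 0 ≤ w s)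
    (hw0 : ∀ s, smax < s → w s = 0)
    (hup : ∀ s, 1 ≤ s → s ≤ smax → w s ≤ x * w (s - 1)) (s : ℕ) : w s ≤ w 0 * x ^ s := by
  induction s with
  | zero => simp
  | succ s ih =>
    rcases le_or_gt (s + 1) smax with hs | hs
    · calc w (s + 1) ≤ x * w s := hup (s + 1) (by omega) hs
        _ ≤ x * (w 0 * x ^ s) := mul_le_mul_of_nonneg_left ih hx
        _ = _ := by ring
    · rw [hw0 _ hs]
      exact mul_nonneg (hw 0) (by positivity)

theorem le_sizePrior {w : ℕ → ℝ} {smax : ℕ} {x : ℝ} (hx : 0 ≤ x)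
    (hlo : ∀ s, 1 ≤ s → s ≤ smax → x * w (s - 1) ≤ w s) {s : ℕ} (hs : s ≤ smax) :
    w 0 * x ^ s ≤ w s := by
  induction s with
  | zero => simp
  | succ s ih =>
    calc w 0 * x ^ (s + 1) = x * (w 0 * x ^ s) := by ring
      _ ≤ x * w s := mul_le_mul_of_nonneg_left (ih (by omega)) hx
      _ ≤ w (s + 1) := hlo (s + 1) (by omega) hs

theorem sum_sizePrior_mul_pow_le {w : ℕ → ℝ} {smax : ℕ} {x a : ℝ} (hx : 0 ≤ x) (ha : 0 ≤ a)
    (hw : ∀ s, 0 ≤ w s) (hw0 : ∀ s, smax < s → w s = 0)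
    (hup : ∀ s, 1 ≤ s → s ≤ smax → w s ≤ x * w (s - 1)) (hxa : x * a ≤ 1 / 2) (m : ℕ) :
    ∑ s ∈ Finset.range m, w s * a ^ s ≤ 2 * w 0 := by
  calc _ ≤ ∑ s ∈ Finset.range m, w 0 * (1 / 2 : ℝ) ^ s := by
        refine Finset.sum_le_sum fun s _ => ?_
        calc w s * a ^ s ≤ w 0 * x ^ s * a ^ s :=
              mul_le_mul_of_nonneg_right (sizePrior_le_mul_pow hx hw hw0 hup s) (by positivity)
          _ = w 0 * (x * a) ^ s := by rw [mul_pow]; ring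
          _ ≤ _ := mul_le_mul_of_nonneg_left
              (pow_le_pow_left₀ (by positivity) hxa s) (hw 0)
    _ = w 0 * ∑ s ∈ Finset.range m, (1 / 2 : ℝ) ^ s := by rw [Finset.mul_sum]
    _ ≤ w 0 * 2 := mul_le_mul_of_nonneg_left (sum_geometric_two_le m) (hw 0)
    _ = _ := by ring

theorem sizePrior_zero_pos {w : ℕ → ℝ} {smax : ℕ} {x : ℝ} (hx : 0 ≤ x) (hw : ∀ s, 0 ≤ w s)
    (hw0 : ∀ s, smax < s → w s = 0)
    (hup : ∀ s, 1 ≤ s → s ≤ smax → w s ≤ x * w (s - 1))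
    (hsum : ∑ s ∈ Finset.range (smax + 1), w s = 1) : 0 < w 0 := by
  refine lt_of_le_of_ne (hw 0) fun h0 => ?_
  have : ∑ s ∈ Finset.range (smax + 1), w s ≤ 0 := Finset.sum_nonpos fun s _ => by
    have := sizePrior_le_mul_pow hx hw hw0 hup s
    rwa [← h0, zero_mul] at this
  linarith

/-- Each factor of the denominator bound costs at most a power of `p`; the constants are absorbed
into two additional powers and the binomial coefficient into a third one. -/
theorem le_supportMass_mul_pow {p smax : ℕ} (hp : 0 < p) {w : ℕ → ℝ} (hw : ∀ s, 0 ≤ w s)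
    {A₁ A₃ κ q : ℝ} (hA₁ : (p : ℝ)⁻¹ ≤ A₁)
    (hlo : ∀ s, 1 ≤ s → s ≤ smax → A₁ * (p : ℝ) ^ (-A₃) * w (s - 1) ≤ w s)
    (hq : (p : ℝ) ^ (-κ - 1) ≤ q) (S : Finset (Fin p)) (hS : S.card ≤ smax) :
    w 0 * ((p : ℝ) ^ (-(A₃ + κ + 3))) ^ S.card ≤ supportMass w S * q ^ S.card := by
  have hP : (0 : ℝ) < p := by exact_mod_cast hp
  have hx : (p : ℝ) ^ (-A₃ - 1) ≤ A₁ * (p : ℝ) ^ (-A₃) := by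
    rw [sub_eq_add_neg, Real.rpow_add hP, Real.rpow_neg_one, mul_comm]
    exact mul_le_mul_of_nonneg_right hA₁ (by positivity)
  have hx0 : 0 ≤ A₁ * (p : ℝ) ^ (-A₃) := le_trans (by positivity) hx
  have h1 := le_sizePrior hx0 hlo hS
  have hch : (0 : ℝ) < p.choose S.card := by
    exact_mod_cast Nat.choose_pos (by simpa using Finset.card_le_univ S)
  have hch' : (p.choose S.card : ℝ) ≤ (p : ℝ) ^ S.card := by
    exact_mod_cast Nat.choose_le_pow p S.card
  have h2 : w 0 * ((p : ℝ) ^ (-A₃ - 1)) ^ S.card * ((p : ℝ) ^ S.card)⁻¹ ≤ supportMass w S := by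
    rw [supportMass, div_eq_mul_inv]
    refine mul_le_mul (le_trans ?_ h1) (inv_anti₀ hch hch') (by positivity) (hw _)
    exact mul_le_mul_of_nonneg_left (pow_le_pow_left₀ (by positivity) hx _) (hw 0)
  calc w 0 * ((p : ℝ) ^ (-(A₃ + κ + 3))) ^ S.card
      = w 0 * ((p : ℝ) ^ (-A₃ - 1)) ^ S.card * ((p : ℝ) ^ S.card)⁻¹
          * ((p : ℝ) ^ (-κ - 1)) ^ S.card := by
        have : (p : ℝ) ^ (-(A₃ + κ + 3))
            = (p : ℝ) ^ (-A₃ - 1) * (p : ℝ)⁻¹ * (p : ℝ) ^ (-κ - 1) := by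
          rw [← Real.rpow_neg_one, ← Real.rpow_add hP, ← Real.rpow_add hP]
          congr 1; ring
        rw [this, mul_pow, mul_pow, inv_pow]; ring
    _ ≤ _ := mul_le_mul h2 (pow_le_pow_left₀ (by positivity) hq _) (by positivity)
        (supportMass_nonneg hw S)

/-! ### Contraction of the posterior -/

/-- The three smallness conditions on the design that the score bound, the lower bound for the slab
and the localization of the estimator require. -/
theorem design_bounds {z s L C : ℝ} (hz : 0 ≤ z) (hs : 1 ≤ s) (hL : 1 ≤ L) (hC : 1 ≤ C)
    (h : z * s * L ≤ 1 / (144 * C ^ 3)) :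
    4 * (z * L) / C ≤ 1 / 4 ∧ z * (C * s) ≤ 1 / 4 ∧
      z * ((3 * C) ^ 2 * (s * (4 * C * L))) ≤ 1 / 4 := by
  have hC0 : 0 < C := by linarith
  have h0 : z * s * L * C ^ 3 ≤ 1 / 144 := by
    rw [le_div_iff₀ (by positivity)] at h
    linarith
  refine ⟨?_, ?_, ?_⟩
  · rw [div_le_iff₀ hC0]
    have h1 : z * L ≤ z * s * L * C ^ 3 :=
      calc z * L ≤ z * s * L := by gcongr; exact le_mul_of_one_le_right hz hs
        _ ≤ _ := le_mul_of_one_le_right (by positivity) (one_le_pow₀ hC)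
    linarith
  · have h1 : z * s * C ≤ z * s * L * C ^ 3 :=
      mul_le_mul (le_mul_of_one_le_right (by positivity) hL) (le_self_pow₀ hC (by norm_num))
        hC0.le (by positivity)
    linarith
  · linarith

/-- Contraction at a fixed sample size, under the inequalities that the asymptotic assumptions
provide for all large `n`. -/
theorem IsFamily.posterior_contraction (h : IsFamily b k μ Cdev) {n p : ℕ} {α : ℝ}
    (hα : α ∈ Set.Ioo (0 : ℝ) 1) (hn : n ≠ 0) {X : Matrix (Fin n) (Fin p) ℝ} {θ₀ : Fin p → ℝ}
    (hθ₀ : θ₀ ≠ 0) {smax : ℕ} (hs : (supp θ₀).card ≤ smax) {w : ℕ → ℝ} {lam D : ℝ}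
    {θbar : ∀ S : Finset (Fin p), S → ℝ} {A₁ A₂ A₃ A₄ A₅ : ℝ} (hA₂ : 0 < A₂)
    (hlog : 1 ≤ Real.log p)
    (hw : ∀ s, 0 ≤ w s) (hw0 : ∀ s, smax < s → w s = 0)
    (hsum : ∑ s ∈ Finset.range (smax + 1), w s = 1)
    (hlo : ∀ s, 1 ≤ s → s ≤ smax → A₁ * (p : ℝ) ^ (-A₃) * w (s - 1) ≤ w s)
    (hup : ∀ s, 1 ≤ s → s ≤ smax → w s ≤ A₂ * (p : ℝ) ^ (-A₄) * w (s - 1))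
    (hD : 0 < D)
    (hbar : ∀ S : Finset (Fin p), S.card ≤ smax → (fisher b (cols X S) (θbar S)).det ≠ 0)
    (hconc : 1 - (p : ℝ)⁻¹ ≤ (law b k μ X θ₀).real (mleEvent b k X smax D θbar))
    (hzeta : zetaSq b k μ X θ₀ * (supp θ₀).card * Real.log p ≤ 1 / (144 * Cdev ^ 3))
    (hlamlo : (p : ℝ) ^ (-A₅) ≤ lam) (hlamup : lam ≤ A₄)
    (hDup : D ≤ (p : ℝ) ^ (A₄ / 4)) (hA₁p : (p : ℝ)⁻¹ ≤ A₁)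
    (hA₂p : √2 * A₂ * (p : ℝ) ^ (-(A₄ / 4)) ≤ 1 / 2)
    (hconst : (p : ℝ)⁻¹
      ≤ Real.exp (-(α * Cdev / 2)) * (2 / √(2 * Real.pi)) * Real.exp (-(A₄ / 2)))
    {K : ℝ} (hK0 : 0 ≤ K) (hK : min α (1 - α) * K ^ 2 = A₃ + A₅ / 2 + 4) :
    Integrable (fun y => posterior b k X w lam α y
        {θ | K * rate n θ₀ < meanHellinger b k μ X θ θ₀}) (law b k μ X θ₀) ∧
      ∫ y, posterior b k X w lam α y {θ | K * rate n θ₀ < meanHellinger b k μ X θ θ₀}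
          ∂(law b k μ X θ₀)
        ≤ (p : ℝ)⁻¹ + 2 * (p : ℝ)⁻¹ + 2 * ((p : ℝ) ^ (supp θ₀).card)⁻¹ := by
  have hC : 0 < Cdev := by linarith [h.one_le]
  have hp : 0 < p := by
    rcases Nat.eq_zero_or_pos p with rfl | hp
    · norm_num at hlog
    · exact hp
  have hP : (0 : ℝ) < p := by exact_mod_cast hp
  have hlam : 0 < lam := lt_of_lt_of_le (by positivity) hlamlo
  have hinj : ∀ S : Finset (Fin p), S.card ≤ smax → Function.Injective (cols X S *ᵥ ·) :=
    fun S hS => injective_of_fisher_det_ne_zero (hbar S hS)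
  have hinj0 := hinj _ hs
  set L := Real.log p with hL
  set S₀ := supp θ₀ with hS₀
  set s₀ : ℝ := (S₀.card : ℝ) with hs₀
  have hs1 : 1 ≤ s₀ := by
    obtain ⟨j, hj⟩ := Function.ne_iff.1 hθ₀
    have : 0 < S₀.card := Finset.card_pos.2 ⟨j, by simpa [hS₀, supp] using hj⟩
    exact Nat.one_le_cast.2 this
  have hsp : s₀ ≤ p := Nat.cast_le.2 ((Finset.card_le_univ S₀).trans_eq (Fintype.card_fin p))
  have hembed : cols X S₀ *ᵥ (fun j : S₀ => θ₀ j) = X *ᵥ θ₀ := by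
    rw [← mulVec_embed, hS₀, embed_supp]
  have hFtrue : fisherTrue b k μ X θ₀ = fisher b (cols X S₀) (fun j => θ₀ j) := by
    unfold fisherTrue
    rw [h.best_eq X θ₀ hinj0 hembed]
  set z := zetaSq b k μ X θ₀ with hzdef
  have hz : ∀ i, cols X S₀ i ⬝ᵥ ((fisher b (cols X S₀) (fun j => θ₀ j))⁻¹ *ᵥ cols X S₀ i) ≤ z := by
    intro i
    rw [← hFtrue, hzdef, zetaSq]
    exact le_ciSup (f := fun i => cols X (supp θ₀) i ⬝ᵥ
      ((fisherTrue b k μ X θ₀)⁻¹ *ᵥ cols X (supp θ₀) i)) (Set.finite_range _).bddAbove i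
  have hz0 : 0 ≤ z := by
    refine le_trans ?_ (hz ⟨0, Nat.pos_of_ne_zero hn⟩)
    simpa using (h.fisher_posDef hinj0 fun j => θ₀ j).inv.posSemidef.dotProduct_mulVec_nonneg
      (cols X S₀ ⟨0, Nat.pos_of_ne_zero hn⟩)
  obtain ⟨hz1, hz2, hz3⟩ := design_bounds hz0 hs1 hlog h.one_le hzeta
  -- With this threshold the Chernoff bound for a coordinate of the score is `p⁻²`, which leaves
  -- `p⁻¹` after the union over at most `p` coordinates.
  set t := √(4 * Cdev * L) with ht
  have ht2 : t ^ 2 = 4 * Cdev * L := Real.sq_sqrt (by positivity)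
  have hL0 : 0 < L := by linarith
  have htz : z * (t / Cdev) ^ 2 ≤ 1 / 4 := by
    have e : z * (t / Cdev) ^ 2 = 4 * (z * L) / Cdev := by
      rw [div_pow, ht2]; field_simp
    rwa [e]
  obtain ⟨N, hN, hNle, hNscore⟩ := h.exists_score_bound X θ₀ hinj0 hembed hz
    (Real.sqrt_nonneg _) htz
  have hNδ : law b k μ X θ₀ N ≤ ENNReal.ofReal (2 * (p : ℝ)⁻¹) := by
    refine hNle.trans (ENNReal.ofReal_le_ofReal ?_)
    have e : Real.exp (-(t ^ 2 / (2 * Cdev))) = (p : ℝ)⁻¹ * (p : ℝ)⁻¹ := by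
      have : -(t ^ 2 / (2 * Cdev)) = -L + -L := by rw [ht2]; field_simp; ring
      rw [this, Real.exp_add, Real.exp_neg, hL, Real.exp_log hP]
    rw [← ht, e, Fintype.card_coe]
    have : s₀ * ((p : ℝ)⁻¹ * (p : ℝ)⁻¹) ≤ (p : ℝ)⁻¹ := by
      rw [← mul_assoc]
      exact mul_le_of_le_one_left (by positivity) (by rwa [← div_eq_mul_inv, div_le_one hP])
    linarith
  set q := Real.exp (-(α * Cdev / 2)) *
    (√lam * (2 / √(2 * Real.pi)) * Real.exp (-(lam / 2))) with hq
  have hqlow : (p : ℝ) ^ (-(A₅ / 2) - 1) ≤ q := by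
    have h1 : (p : ℝ) ^ (-(A₅ / 2)) ≤ √lam := by
      refine le_trans (le_of_eq ?_) (Real.sqrt_le_sqrt hlamlo)
      rw [Real.sqrt_eq_rpow, ← Real.rpow_mul hP.le]
      congr 1; ring
    calc (p : ℝ) ^ (-(A₅ / 2) - 1) = (p : ℝ) ^ (-(A₅ / 2)) * (p : ℝ)⁻¹ := by
          rw [sub_eq_add_neg, Real.rpow_add hP, Real.rpow_neg_one]
      _ ≤ √lam * (Real.exp (-(α * Cdev / 2)) * (2 / √(2 * Real.pi)) * Real.exp (-(A₄ / 2))) :=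
          mul_le_mul h1 hconst (by positivity) (by positivity)
      _ ≤ √lam * (Real.exp (-(α * Cdev / 2)) * (2 / √(2 * Real.pi)) * Real.exp (-(lam / 2))) := by
          gcongr
      _ = q := by rw [hq]; ring
  have hx0 : 0 ≤ A₂ * (p : ℝ) ^ (-A₄) := by positivity
  have hw0pos : 0 < w 0 := sizePrior_zero_pos hx0 hw hw0 hup hsum
  set d := supportMass w S₀ * q ^ S₀.card with hd
  have hdlow : w 0 * ((p : ℝ) ^ (-(A₃ + A₅ / 2 + 3))) ^ S₀.card ≤ d :=
    le_supportMass_mul_pow hp hw hA₁p hlo hqlow S₀ hs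
  have hdpos : 0 < d := lt_of_lt_of_le (by positivity) hdlow
  have hden : ∀ y ∈ mleEvent b k X smax D θbar, y ∉ N →
      ENNReal.ofReal (Real.exp (α * logLik b k X y θ₀)) * ENNReal.ofReal d
        ≤ ∫⁻ θ, ENNReal.ofReal (Real.exp (α * logLik b k X y θ)) ∂(prior b k X w lam y) := by
    intro y hy hyN
    have hm := isMLE_mle (hy S₀ hs).1
    refine h.le_denominator hα.1.le hinj0 hw hlam hz ?_ hm ?_
    · exact hz2
    · refine h.mle_localization hinj0 hz (R := √(s₀ * t ^ 2)) ?_ (fun v => ?_) ?_ hm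
      · rw [ht2]; positivity
      · rw [Real.sq_sqrt (by positivity)]
        have := hNscore y hyN v
        rwa [Fintype.card_coe] at this
      · rwa [mul_pow, Real.sq_sqrt (by positivity), ht2]
  set a := √2 * D * Real.exp (lam * L / 2) with ha
  have ha0 : 0 ≤ a := by positivity
  have hxa : A₂ * (p : ℝ) ^ (-A₄) * a ≤ 1 / 2 := by
    have h1 : Real.exp (lam * L / 2) ≤ (p : ℝ) ^ (A₄ / 2) := by
      rw [Real.rpow_def_of_pos hP, ← hL]
      refine Real.exp_le_exp.2 ?_
      nlinarith
    calc A₂ * (p : ℝ) ^ (-A₄) * a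
        ≤ A₂ * (p : ℝ) ^ (-A₄) * (√2 * (p : ℝ) ^ (A₄ / 4) * (p : ℝ) ^ (A₄ / 2)) := by
          rw [ha]; gcongr
      _ = √2 * A₂ * ((p : ℝ) ^ (-A₄) * (p : ℝ) ^ (A₄ / 4) * (p : ℝ) ^ (A₄ / 2)) := by ring
      _ = √2 * A₂ * (p : ℝ) ^ (-(A₄ / 4)) := by
          rw [← Real.rpow_add hP, ← Real.rpow_add hP]
          congr 2; ring
      _ ≤ 1 / 2 := hA₂p
  set r := K ^ 2 * (s₀ * L) with hr
  have hAr : ∀ θ ∈ {θ | K * rate n θ₀ < meanHellinger b k μ X θ θ₀},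
      r ≤ n * meanHellinger b k μ X θ θ₀ ^ 2 := by
    intro θ hθ
    have hθ' : K * rate n θ₀ < meanHellinger b k μ X θ θ₀ := hθ
    have hn' : (0 : ℝ) < n := by exact_mod_cast Nat.pos_of_ne_zero hn
    have hrate0 : 0 ≤ rate n θ₀ := Real.sqrt_nonneg _
    have hrate : rate n θ₀ ^ 2 = s₀ * L / n := Real.sq_sqrt (by positivity)
    have h1 := pow_le_pow_left₀ (mul_nonneg hK0 hrate0) hθ'.le 2
    rw [mul_pow, hrate] at h1
    have h2 := mul_le_mul_of_nonneg_left h1 hn'.le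
    refine le_trans (le_of_eq ?_) h2
    rw [hr]; field_simp
  have hnum := h.lintegral_numerator_le hα hn θ₀ hinj hw hw0 hlam hD θbar
    (h.measurableSet_hellinger_lt X θ₀ (K * rate n θ₀)) hAr
  set u := (∑ S : Finset (Fin p), supportMass w S * a ^ S.card) *
    Real.exp (-(min α (1 - α) * r)) with hu
  have hsum0 : 0 ≤ ∑ S : Finset (Fin p), supportMass w S * a ^ S.card :=
    Finset.sum_nonneg fun S _ => mul_nonneg (supportMass_nonneg hw S) (by positivity)
  have hu0 : 0 ≤ u := mul_nonneg hsum0 (Real.exp_pos _).le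
  obtain ⟨hint, hle⟩ := h.posterior_le (α := α) (δ := (p : ℝ)⁻¹) (δ' := 2 * (p : ℝ)⁻¹) hinj hw0
    hlam (h.measurableSet_hellinger_lt X θ₀ (K * rate n θ₀))
    (h.measurableSet_mleEvent hinj D θbar) hN hdpos hu0 (by positivity) (by positivity) hconc hNδ
    hden hnum
  refine ⟨hint, hle.trans (add_le_add_right ?_ _)⟩
  rw [div_le_iff₀ hdpos]
  have hexp : Real.exp (-(min α (1 - α) * r))
      = ((p : ℝ) ^ S₀.card)⁻¹ * ((p : ℝ) ^ (-(A₃ + A₅ / 2 + 3))) ^ S₀.card := by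
    have e : -(min α (1 - α) * r) = (S₀.card : ℝ) * (-L + -(A₃ + A₅ / 2 + 3) * L) := by
      rw [hr, ← mul_assoc, hK, ← hs₀]; ring
    rw [e, Real.exp_nat_mul, Real.exp_add, mul_pow, Real.exp_neg, hL, Real.exp_log hP, inv_pow,
      Real.rpow_def_of_pos hP, mul_comm (Real.log p)]
  calc u ≤ 2 * w 0 * Real.exp (-(min α (1 - α) * r)) := by
        rw [hu, sum_supportMass_mul_pow]
        exact mul_le_mul_of_nonneg_right
          (sum_sizePrior_mul_pow_le hx0 ha0 hw hw0 hup hxa _) (Real.exp_pos _).le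
    _ = 2 * ((p : ℝ) ^ S₀.card)⁻¹ * (w 0 * ((p : ℝ) ^ (-(A₃ + A₅ / 2 + 3))) ^ S₀.card) := by
        rw [hexp]; ring
    _ ≤ _ := mul_le_mul_of_nonneg_left hdlow (by positivity)

end SparseGLM

theorem theorem3p2
    (b k : ℝ → ℝ) (μ : Measure ℝ) (Cdev : ℝ) (hfam : SparseGLM.IsFamily b k μ Cdev)
    (α C B A₁ A₂ A₃ A₄ A₅ A₆ A₇ : ℝ) (hα : α ∈ Set.Ioo (0 : ℝ) 1) (hC : 0 < C)
    (hA₁ : 0 < A₁) (hA₂ : 0 < A₂) (hA₃ : 0 < A₃) (hA₄ : 0 < A₄) (hA₅ : 0 < A₅)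
    (hA₆ : 0 < A₆) (hA₇ : 0 ≤ A₇) :
    ∃ KHel : ℝ, 0 < KHel ∧
      ∀ (p : ℕ → ℕ) (X : ∀ n, Matrix (Fin n) (Fin (p n)) ℝ) (θ₀ : ∀ n, Fin (p n) → ℝ)
        (smax : ℕ → ℕ) (w : ℕ → ℕ → ℝ) (lam D : ℕ → ℝ)
        (θbar : ∀ n, ∀ S : Finset (Fin (p n)), S → ℝ),
        SparseGLM.Standing C p X θ₀ smax →
        SparseGLM.SizePrior A₁ A₂ A₃ A₄ p smax w →
        SparseGLM.AssumptionOne b k μ p X θ₀ smax D θbar →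
        SparseGLM.AssumptionTwo b k μ B A₄ A₅ A₆ A₇ p X θ₀ lam D →
        ∀ᶠ n : ℕ in atTop,
          Integrable (fun y => SparseGLM.posterior b k (X n) (w n) (lam n) α y
              {θ | KHel * SparseGLM.rate n (θ₀ n)
                < SparseGLM.meanHellinger b k μ (X n) θ (θ₀ n)})
            (SparseGLM.law b k μ (X n) (θ₀ n)) ∧
          ∫ y, SparseGLM.posterior b k (X n) (w n) (lam n) α y
              {θ | KHel * SparseGLM.rate n (θ₀ n)
                < SparseGLM.meanHellinger b k μ (X n) θ (θ₀ n)}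
            ∂(SparseGLM.law b k μ (X n) (θ₀ n))
            ≤ 2 * (((SparseGLM.supp (θ₀ n)).card : ℝ) * Real.log (p n))⁻¹
              + 4 * (p n : ℝ)⁻¹ + 2 * ((p n : ℝ) ^ (SparseGLM.supp (θ₀ n)).card)⁻¹ := by
  obtain ⟨hα0, hα1⟩ := hα
  have hc : 0 < min α (1 - α) := lt_min hα0 (by linarith)
  have hCdev : 1 ≤ Cdev := hfam.one_le
  -- The exponent of the numerator has to beat that of the denominator by one power of `p ^ s₀`.
  refine ⟨√((A₃ + A₅ / 2 + 4) / min α (1 - α)), Real.sqrt_pos.2 (by positivity), ?_⟩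
  intro p X θ₀ smax w lam D θbar hst hsize hone htwo
  have hp : Tendsto (fun n => (p n : ℝ)) atTop atTop :=
    tendsto_atTop_mono' _ hst.dim ((tendsto_rpow_atTop hC).comp tendsto_natCast_atTop_atTop)
  have hlog : Tendsto (fun n => Real.log (p n)) atTop atTop := Real.tendsto_log_atTop.comp hp
  have hinv : Tendsto (fun n => (p n : ℝ)⁻¹) atTop (𝓝 0) := tendsto_inv_atTop_zero.comp hp
  have hpow : Tendsto (fun n => √2 * A₂ * (p n : ℝ) ^ (-(A₄ / 4))) atTop (𝓝 0) := by
    simpa using ((tendsto_rpow_neg_atTop (show 0 < A₄ / 4 by positivity)).comp hp).const_mul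
      (√2 * A₂)
  have hconst : 0 < Real.exp (-(α * Cdev / 2)) * (2 / √(2 * Real.pi)) * Real.exp (-(A₄ / 2)) := by
    positivity
  have hzeta : (0 : ℝ) < 1 / (144 * Cdev ^ 3) := by positivity
  filter_upwards [eventually_ne_atTop 0, hst.nonzero, hst.sparse, hsize.nonneg, hsize.zero,
    hsize.sum_one, hsize.lower, hsize.upper, hone.D_gt, hone.nonsing_bar, hone.conc,
    hone.design.eventually_le_const hzeta, htwo.lam_lower, htwo.lam_upper, htwo.lam_A₄,
    htwo.log_D.eventually_le_const (show 0 < A₄ / 4 by positivity),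
    hlog.eventually_ge_atTop 1, hinv.eventually_le_const hA₁,
    hpow.eventually_le_const (show (0 : ℝ) < 1 / 2 by norm_num),
    hinv.eventually_le_const hconst] with n hn h1 h2 h3 h4 h5 h6 h7 h8 h9 h10 h11 h12 h13 h14 h15
    h16 h17 h18 h19
  have hD : 0 < D n := (Real.sqrt_nonneg 2).trans_lt h8
  have hL : 0 < Real.log (p n) := by linarith
  have hp0 : (0 : ℝ) < p n := by
    rcases Nat.eq_zero_or_pos (p n) with h0 | h0
    · rw [h0] at hL
      norm_num at hL
    · exact_mod_cast h0
  have hDup : D n ≤ (p n : ℝ) ^ (A₄ / 4) := by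
    rw [div_le_iff₀ hL] at h15
    rw [Real.rpow_def_of_pos hp0, ← Real.exp_log hD]
    exact Real.exp_le_exp.2 (by linarith)
  obtain ⟨hint, hle⟩ := hfam.posterior_contraction ⟨hα0, hα1⟩ hn h1 h2 hA₂ h16 h3 h4 h5 h6 h7 hD h9
    h10 h11 h12 (h13.trans h14.le) hDup h17 h18 h19
    (Real.sqrt_nonneg ((A₃ + A₅ / 2 + 4) / min α (1 - α)))
    (by rw [Real.sq_sqrt (by positivity)]; field_simp)
  refine ⟨hint, hle.trans ?_⟩
  have h20 : 0 ≤ 2 * (((SparseGLM.supp (θ₀ n)).card : ℝ) * Real.log (p n))⁻¹ := by positivity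
  have h21 : (0 : ℝ) ≤ (p n : ℝ)⁻¹ := by positivity
  linarith
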